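/- Let $P_0(D)=\sum_{|\alpha|\le m}a_\alpha D^\alpha$, $D_j=-i\,\partial/\partial x_j$, be a partial differential operator on $\mathbb{R}^n$ of order $m\ge 2$ with constant real coefficients. Put $\widetilde P_0(\xi)=\bigl(\sum_{\alpha}|\partial^\alpha P_0(\xi)|^2\bigr)^{1/2}$ and assume that $\widetilde P_0(\xi)\to\infty$ as $|\xi|\to\infty$ and that $P_0(\xi)$ or $-P_0(\xi)$ is bounded from below on $\mathbb{R}^n$. Let $\Omega\subset\mathbb{R}^n$ be a bounded domain, and let $V\in L^\infty(\mathbb{R}^n)$ be real-valued with $\operatorname{supp}V=\overline\Omega$ and $V\ge\delta$ a.e. in $\overline\Omega$, for a constant $\delta>0$. Write $\|\cdot\|$ for the norm of $L^2(\Omega)$ (complex-valued functions). Let $H_0^{P_0}(\Omega)$ be the completion of $C_0^\infty(\Omega)$ in the norm $\|P_0(D)\varphi\|$, regarded as a subspace of $L^2(\Omega)$. A number $\lambda\in\mathbb{C}$ is a transmission eigenvalue if there are $0\ne v\in L^2_{\rm loc}(\Omega)$ and $0\ne w\in L^2_{\rm loc}(\Omega)$ with $(P_0-\lambda)v=0$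 and $(P_0+V-\lambda)w=0$ in $\mathcal{D}'(\Omega)$ and $v-w\in H_0^{P_0}(\Omega)$. The multiplicity of a real transmission eigenvalue $\lambda$ is the multiplicity of $0$ as an eigenvalue of $T_\lambda=(P_0+V-\lambda)\frac1V(P_0-\lambda)$, i.e. the dimension of $\{u\in H_0^{P_0}(\Omega): T_\lambda u=0 \text{ in }\mathcal{D}'(\Omega)\}$. Suppose that there is a $p$-dimensional subspace $V^p\subset H_0^{P_0}(\Omega)$ such that $$\delta\ \ge\ 2\,\frac{\|P_0u\|}{\|u\|}\qquad\text{for all } 0\ne u\in V^p .$$ Then there exist $p$ real transmission eigenvalues, counted with multiplicity: there are $\lambda_1,\dots,\lambda_p\in\mathbb{R}$, each of them a transmission eigenvalue, such that no value occurs among them more often than its (finite) multiplicity. -/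

import Mathlib

open MeasureTheory Set Filter Topology TopologicalSpace
open scoped Distributions ENNReal

namespace TransmissionProblem

noncomputable section

/-- The Euclidean space `ℝⁿ`. -/
abbrev Space (n : ℕ) : Type := EuclideanSpace ℝ (Fin n)

/-- Complex-valued `L²(Ω)`, with respect to Lebesgue measure. -/
abbrev L2 {n : ℕ} (Ω : Opens (Space n)) : Type :=
  Lp ℂ 2 ((volume : Measure (Space n)).restrict (Ω : Set (Space n)))

/-- `D_j = -i ∂/∂x_j`, acting on `C₀^∞(Ω)`. -/
def dOp {n : ℕ} (Ω : Opens (Space n)) (j : Fin n) : Module.End ℂ 𝓓(Ω, ℂ) :=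
  (-Complex.I) •
    (TestFunction.lineDerivCLM ℂ (EuclideanSpace.single j (1 : ℝ)) :
      𝓓(Ω, ℂ) →L[ℂ] 𝓓(Ω, ℂ)).toLinearMap

/-- `D^α = D_1^{α_1} ⋯ D_n^{α_n}`, acting on `C₀^∞(Ω)`. -/
def dPow {n : ℕ} (Ω : Opens (Space n)) (α : Fin n →₀ ℕ) : Module.End ℂ 𝓓(Ω, ℂ) :=
  (List.ofFn fun j => dOp Ω j ^ α j).prod

/-- `P(D) = ∑_α a_α D^α`, acting on `C₀^∞(Ω)`, for the real polynomial `P(ξ) = ∑_α a_α ξ^α`. -/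
def polyOp {n : ℕ} (P : MvPolynomial (Fin n) ℝ) (Ω : Opens (Space n)) :
    Module.End ℂ 𝓓(Ω, ℂ) :=
  ∑ α ∈ P.support, ((P.coeff α : ℝ) : ℂ) • dPow Ω α

/-- The real symbol `ξ ↦ P(ξ)`. -/
def symbol {n : ℕ} (P : MvPolynomial (Fin n) ℝ) (ξ : Space n) : ℝ :=
  MvPolynomial.eval (fun j => ξ j) P

/-- `∂^α P`, the formal partial derivative of the polynomial `P`. -/
def polyDeriv {n : ℕ} (α : Fin n → ℕ) (P : MvPolynomial (Fin n) ℝ) : MvPolynomial (Fin n) ℝ :=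
  (List.ofFn fun j => ((MvPolynomial.pderiv j).toLinearMap :
    Module.End ℝ (MvPolynomial (Fin n) ℝ)) ^ α j).prod P

/-- `P̃(ξ) = (∑_α |∂^α P(ξ)|²)^{1/2}`. The sum is over all multi-indices with entries at most the
degree of `P`; all other derivatives of `P` vanish identically. (Replacing `∂` by `-i∂` does not
change the absolute values.) -/
def symbolTilde {n : ℕ} (P : MvPolynomial (Fin n) ℝ) (ξ : Space n) : ℝ :=
  Real.sqrt (∑ α : Fin n → Fin (P.totalDegree + 1),
    |symbol (polyDeriv (fun j => (α j : ℕ)) P) ξ| ^ 2)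

theorem memLp_testFunction {n : ℕ} {Ω : Opens (Space n)} (φ : 𝓓(Ω, ℂ)) :
    MemLp φ 2 ((volume : Measure (Space n)).restrict (Ω : Set (Space n))) :=
  (φ.continuous.memLp_of_hasCompactSupport φ.hasCompactSupport).restrict _

/-- The inclusion `C₀^∞(Ω) → L²(Ω)`. -/
def testToL2 {n : ℕ} (Ω : Opens (Space n)) : 𝓓(Ω, ℂ) →ₗ[ℂ] L2 Ω where
  toFun φ := (memLp_testFunction φ).toLp φ
  map_add' φ ψ := by
    rw [← MemLp.toLp_add]; rfl
  map_smul' c φ := by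
    rw [RingHom.id_apply, ← MemLp.toLp_const_smul]; rfl

/-- The closure in `L²(Ω) × L²(Ω)` of the graph `{(φ, P(D)φ) : φ ∈ C₀^∞(Ω)}`. -/
def minGraph {n : ℕ} (P : MvPolynomial (Fin n) ℝ) (Ω : Opens (Space n)) :
    Submodule ℂ (L2 Ω × L2 Ω) :=
  (LinearMap.range ((testToL2 Ω).prod (testToL2 Ω ∘ₗ polyOp P Ω))).topologicalClosure

theorem dOp_apply {n : ℕ} {Ω : Opens (Space n)} (j : Fin n) (φ : 𝓓(Ω, ℂ)) (x : Space n) :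
    dOp Ω j φ x = -Complex.I * fderiv ℝ φ x (EuclideanSpace.single j (1 : ℝ)) := by
  have hd : DifferentiableAt ℝ φ x := (φ.contDiff.differentiable (by simp)).differentiableAt
  have h : (TestFunction.lineDerivCLM ℂ (EuclideanSpace.single j (1 : ℝ)) φ : 𝓓(Ω, ℂ)) x =
      fderiv ℝ φ x (EuclideanSpace.single j (1 : ℝ)) := by
    rw [TestFunction.lineDerivCLM_apply_of_le (by simp), hd.lineDeriv_eq_fderiv]
  rw [← h]
  rfl

theorem inner_testToL2 {n : ℕ} {Ω : Opens (Space n)} (φ : 𝓓(Ω, ℂ)) (f : L2 Ω) :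
    inner ℂ (testToL2 Ω φ) f = ∫ x in (Ω : Set (Space n)), f x * starRingEnd ℂ (φ x) := by
  rw [MeasureTheory.L2.inner_def]
  refine integral_congr_ae ?_
  filter_upwards [MemLp.coeFn_toLp (memLp_testFunction φ)] with x hx
  simp only [testToL2, LinearMap.coe_mk, AddHom.coe_mk, hx]
  rfl

theorem inner_testToL2_testToL2 {n : ℕ} {Ω : Opens (Space n)} (φ ψ : 𝓓(Ω, ℂ)) :
    inner ℂ (testToL2 Ω φ) (testToL2 Ω ψ) = ∫ x, starRingEnd ℂ (φ x) * ψ x := by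
  have hΩ : ∫ x in (Ω : Set (Space n)), starRingEnd ℂ (φ x) * ψ x =
      ∫ x, starRingEnd ℂ (φ x) * ψ x := by
    refine setIntegral_eq_integral_of_forall_compl_eq_zero fun x hx => ?_
    have : φ x = 0 := image_eq_zero_of_notMem_tsupport fun h => hx (φ.tsupport_subset h)
    simp [this]
  rw [inner_testToL2, ← hΩ]
  · refine integral_congr_ae ?_
    filter_upwards [MemLp.coeFn_toLp (memLp_testFunction ψ)] with x hx
    simp only [testToL2, LinearMap.coe_mk, AddHom.coe_mk, hx]
    ring

theorem dOp_symm {n : ℕ} {Ω : Opens (Space n)} (j : Fin n) (φ ψ : 𝓓(Ω, ℂ)) :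
    inner ℂ (testToL2 Ω φ) (testToL2 Ω (dOp Ω j ψ)) =
      inner ℂ (testToL2 Ω (dOp Ω j φ)) (testToL2 Ω ψ) := by
  set e : Space n := EuclideanSpace.single j (1 : ℝ)
  have hφ : ContDiff ℝ 1 φ := φ.contDiff.of_le (by exact_mod_cast le_top)
  have hψ : ContDiff ℝ 1 ψ := ψ.contDiff.of_le (by exact_mod_cast le_top)
  have hφ' : Continuous fun x => fderiv ℝ φ x e :=
    (hφ.continuous_fderiv one_ne_zero).clm_apply continuous_const
  have hψ' : Continuous fun x => fderiv ℝ ψ x e :=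
    (hψ.continuous_fderiv one_ne_zero).clm_apply continuous_const
  have key := integral_bilinear_hasFDerivAt_right_eq_neg_left_of_integrable
    (μ := (volume : Measure (Space n))) (v := e)
    (B := (ContinuousLinearMap.mul ℝ ℂ).comp (Complex.conjCLE : ℂ →L[ℝ] ℂ))
    (f := φ) (f' := fderiv ℝ φ) (g := ψ) (g' := fderiv ℝ ψ) ?_ ?_ ?_
    (fun x _ => (hφ.differentiable one_ne_zero x).hasFDerivAt)
    (fun x _ => (hψ.differentiable one_ne_zero x).hasFDerivAt)
  · simp only [inner_testToL2_testToL2, dOp_apply]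
    simp only [ContinuousLinearMap.comp_apply, ContinuousLinearMap.mul_apply',
      ContinuousLinearEquiv.coe_coe, Complex.conjCLE_apply] at key
    calc ∫ x, starRingEnd ℂ (φ x) * (-Complex.I * fderiv ℝ ψ x e)
        = -Complex.I * ∫ x, starRingEnd ℂ (φ x) * fderiv ℝ ψ x e := by
          rw [← integral_const_mul]; congr 1; ext x; ring
      _ = Complex.I * ∫ x, starRingEnd ℂ (fderiv ℝ φ x e) * ψ x := by rw [key]; ring
      _ = _ := by
          rw [← integral_const_mul]; congr 1; ext x
          simp only [map_mul, map_neg, Complex.conj_I]; ring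
  · exact (by fun_prop : Continuous _).integrable_of_hasCompactSupport
      (ψ.hasCompactSupport.mono fun x hx h => hx (by simp [h]))
  · exact (by fun_prop : Continuous _).integrable_of_hasCompactSupport
      (φ.hasCompactSupport.mono fun x hx h => hx (by simp [h]))
  · exact (by fun_prop : Continuous _).integrable_of_hasCompactSupport
      (ψ.hasCompactSupport.mono fun x hx h => hx (by simp [h]))

theorem exists_adjoint_list {n : ℕ} {Ω : Opens (Space n)} (l : List (Module.End ℂ 𝓓(Ω, ℂ)))
    (hl : ∀ A ∈ l, ∃ B : 𝓓(Ω, ℂ) → 𝓓(Ω, ℂ), ∀ φ ψ,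
      inner ℂ (testToL2 Ω φ) (testToL2 Ω (A ψ)) = inner ℂ (testToL2 Ω (B φ)) (testToL2 Ω ψ)) :
    ∃ B : 𝓓(Ω, ℂ) → 𝓓(Ω, ℂ), ∀ φ ψ,
      inner ℂ (testToL2 Ω φ) (testToL2 Ω (l.prod ψ)) =
        inner ℂ (testToL2 Ω (B φ)) (testToL2 Ω ψ) := by
  induction l with
  | nil => exact ⟨id, fun φ ψ => rfl⟩
  | cons A l ih =>
    obtain ⟨B, hB⟩ := hl A (by simp)
    obtain ⟨C, hC⟩ := ih fun A hA => hl A (by simp [hA])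
    refine ⟨fun φ => C (B φ), fun φ ψ => ?_⟩
    rw [List.prod_cons, Module.End.mul_apply, hB, hC]

theorem exists_adjoint_polyOp {n : ℕ} (P : MvPolynomial (Fin n) ℝ) (Ω : Opens (Space n)) :
    ∃ B : 𝓓(Ω, ℂ) → 𝓓(Ω, ℂ), ∀ φ ψ,
      inner ℂ (testToL2 Ω φ) (testToL2 Ω (polyOp P Ω ψ)) =
        inner ℂ (testToL2 Ω (B φ)) (testToL2 Ω ψ) := by
  have h : ∀ α : Fin n →₀ ℕ, ∃ B : 𝓓(Ω, ℂ) → 𝓓(Ω, ℂ), ∀ φ ψ,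
      inner ℂ (testToL2 Ω φ) (testToL2 Ω (dPow Ω α ψ)) =
        inner ℂ (testToL2 Ω (B φ)) (testToL2 Ω ψ) := fun α => by
    refine exists_adjoint_list _ fun A hA => ?_
    obtain ⟨j, rfl⟩ := (List.mem_ofFn' _ _).1 hA
    have := exists_adjoint_list (List.replicate (α j) (dOp Ω j)) fun A hA => by
      rw [List.eq_of_mem_replicate hA]
      exact ⟨dOp Ω j, dOp_symm j⟩
    simpa only [List.prod_replicate] using this
  choose B hB using h
  refine ⟨fun φ => ∑ α ∈ P.support, ((P.coeff α : ℝ) : ℂ) • B α φ, fun φ ψ => ?_⟩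
  simp only [polyOp, LinearMap.sum_apply, LinearMap.smul_apply, map_sum, map_smul, inner_sum,
    sum_inner, inner_smul_left, inner_smul_right, hB, Complex.conj_ofReal]

/-- The operator `P(D)` on `C₀^∞(Ω)` is closable in `L²(Ω)`. -/
theorem minGraph_single_valued {n : ℕ} (P : MvPolynomial (Fin n) ℝ) (Ω : Opens (Space n))
    (z : L2 Ω × L2 Ω) (hz : z ∈ minGraph P Ω) (hz1 : z.1 = 0) : z.2 = 0 := by
  obtain ⟨B, hB⟩ := exists_adjoint_polyOp P Ω
  have h0 : ∀ φ : 𝓓(Ω, ℂ), inner ℂ (testToL2 Ω φ) z.2 = inner ℂ (testToL2 Ω (B φ)) z.1 := by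
    intro φ
    have hcl : IsClosed {z : L2 Ω × L2 Ω |
        inner ℂ (testToL2 Ω φ) z.2 = inner ℂ (testToL2 Ω (B φ)) z.1} :=
      isClosed_eq (continuous_const.inner continuous_snd) (continuous_const.inner continuous_fst)
    refine closure_minimal ?_ hcl hz
    rintro _ ⟨ψ, rfl⟩
    exact hB φ ψ
  have hloc : LocallyIntegrableOn z.2 (Ω : Set (Space n)) volume := by
    intro x hx
    obtain ⟨K, hK, hxK, hKΩ⟩ := exists_compact_subset Ω.isOpen hx
    refine ⟨K, mem_nhdsWithin_of_mem_nhds (mem_interior_iff_mem_nhds.1 hxK), ?_⟩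
    have hm : MemLp z.2 2 (volume.restrict K) :=
      (Lp.memLp z.2).mono_measure (Measure.restrict_mono hKΩ le_rfl)
    have : IsFiniteMeasure ((volume : Measure (Space n)).restrict K) :=
      ⟨by simpa using hK.measure_lt_top⟩
    exact hm.integrable (by norm_num)
  have := Ω.isOpen.ae_eq_zero_of_integral_contDiff_smul_eq_zero hloc fun g hg hgc hgs => by
    let φ : 𝓓(Ω, ℂ) := ⟨fun x => (g x : ℂ), Complex.ofRealCLM.contDiff.comp hg,
      hgc.comp_left (g := fun t : ℝ => (t : ℂ)) (by simp),
      (closure_mono (Function.support_comp_subset (g := fun t : ℝ => (t : ℂ))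
        Complex.ofReal_zero g)).trans hgs⟩
    have h := h0 φ
    rw [hz1, inner_zero_right, inner_testToL2,
      setIntegral_eq_integral_of_forall_compl_eq_zero] at h
    · rw [← h]
      congr 1; ext x
      change (g x : ℝ) • z.2 x = z.2 x * starRingEnd ℂ (g x : ℂ)
      rw [Complex.conj_ofReal, Complex.real_smul, mul_comm]
    · intro x hx
      have : φ x = 0 := image_eq_zero_of_notMem_tsupport fun h => hx (φ.tsupport_subset h)
      simp [this]
  refine (Lp.eq_zero_iff_ae_eq_zero).2 ?_
  exact (ae_restrict_iff' Ω.isOpen.measurableSet).2 this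

/-- `P₀` as a closed operator in `L²(Ω)` with domain `H₀^{P₀}(Ω)`: the closure of `P₀(D)` on
`C₀^∞(Ω)`. The closure of the graph is again a graph, see `minGraph_single_valued`. -/
def minOp {n : ℕ} (P : MvPolynomial (Fin n) ℝ) (Ω : Opens (Space n)) : L2 Ω →ₗ.[ℂ] L2 Ω :=
  (minGraph P Ω).toLinearPMap

/-- `H₀^{P₀}(Ω)`, the completion of `C₀^∞(Ω)` in the norm `‖P₀(D)φ‖`, realised inside `L²(Ω)`:
`u` belongs to it iff there are `φ_k ∈ C₀^∞(Ω)` with `φ_k → u` and `P₀(D)φ_k` convergent in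
`L²(Ω)`; the limit of `P₀(D)φ_k` is `P₀u = minOp P Ω u`. For bounded `Ω` and `P₀ ≠ 0` one has
`‖φ‖ ≤ C ‖P₀(D)φ‖` on `C₀^∞(Ω)`, so that sequences which are Cauchy for `‖P₀(D)φ‖` are exactly
those for which both `φ_k` and `P₀(D)φ_k` converge in `L²(Ω)`. -/
abbrev H0 {n : ℕ} (P : MvPolynomial (Fin n) ℝ) (Ω : Opens (Space n)) : Submodule ℂ (L2 Ω) :=
  (minOp P Ω).domain

/-- `(P(D) + V - lam) g = 0` in `𝓓'(Ω)`: for every test function `φ`,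
`∫_Ω g · conj ((P(D) + V - conj lam) φ) = 0`, the integral being convergent. Since `P` and `V` are
real and `conj φ` runs over all test functions, this is the distributional equation. -/
def WeakSol {n : ℕ} (P : MvPolynomial (Fin n) ℝ) (Ω : Opens (Space n)) (V : Space n → ℝ)
    (lam : ℂ) (g : Space n → ℂ) : Prop :=
  ∀ φ : 𝓓(Ω, ℂ),
    IntegrableOn (fun x => g x * starRingEnd ℂ
      (polyOp P Ω φ x + (V x : ℂ) * φ x - starRingEnd ℂ lam * φ x)) Ω volume ∧
    ∫ x in (Ω : Set (Space n)), g x * starRingEnd ℂ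
      (polyOp P Ω φ x + (V x : ℂ) * φ x - starRingEnd ℂ lam * φ x) = 0

/-- `g ∈ L²_loc(Ω)`. -/
def L2Loc {n : ℕ} (Ω : Opens (Space n)) (g : Space n → ℂ) : Prop :=
  ∀ K : Set (Space n), IsCompact K → K ⊆ Ω → MemLp g 2 (volume.restrict K)

/-- `lam` is a (interior) transmission eigenvalue: there are `0 ≠ v, w ∈ L²_loc(Ω)` with
`(P₀ - lam) v = 0` and `(P₀ + V - lam) w = 0` in `Ω`, and `v - w ∈ H₀^{P₀}(Ω)`. -/
def IsTransmissionEigenvalue {n : ℕ} (P : MvPolynomial (Fin n) ℝ) (Ω : Opens (Space n))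
    (V : Space n → ℝ) (lam : ℂ) : Prop :=
  ∃ v w : Space n → ℂ, L2Loc Ω v ∧ L2Loc Ω w ∧
    ¬ (v =ᵐ[volume.restrict (Ω : Set (Space n))] 0) ∧
    ¬ (w =ᵐ[volume.restrict (Ω : Set (Space n))] 0) ∧
    WeakSol P Ω 0 lam v ∧ WeakSol P Ω V lam w ∧
    ∃ u : H0 P Ω, v - w =ᵐ[volume.restrict (Ω : Set (Space n))] (u : L2 Ω)

/-- `(1/V) (P₀ - lam) u`, for `u ∈ H₀^{P₀}(Ω)`. -/
def innerFactor {n : ℕ} (P : MvPolynomial (Fin n) ℝ) (Ω : Opens (Space n)) (V : Space n → ℝ)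
    (lam : ℂ) (u : H0 P Ω) : Space n → ℂ :=
  fun x => ((V x : ℂ))⁻¹ * (minOp P Ω u x - lam * (u : L2 Ω) x)

theorem innerFactor_add {n : ℕ} (P : MvPolynomial (Fin n) ℝ) (Ω : Opens (Space n))
    (V : Space n → ℝ) (lam : ℂ) (u u' : H0 P Ω) :
    innerFactor P Ω V lam (u + u') =ᵐ[volume.restrict (Ω : Set (Space n))]
      fun x => innerFactor P Ω V lam u x + innerFactor P Ω V lam u' x := by
  have h1 := Lp.coeFn_add (minOp P Ω u) (minOp P Ω u')
  have h2 := Lp.coeFn_add (u : L2 Ω) (u' : L2 Ω)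
  filter_upwards [h1, h2] with x h1 h2
  simp only [innerFactor, LinearPMap.map_add, Submodule.coe_add, h1, h2, Pi.add_apply]
  ring

theorem innerFactor_smul {n : ℕ} (P : MvPolynomial (Fin n) ℝ) (Ω : Opens (Space n))
    (V : Space n → ℝ) (lam c : ℂ) (u : H0 P Ω) :
    innerFactor P Ω V lam (c • u) =ᵐ[volume.restrict (Ω : Set (Space n))]
      fun x => c * innerFactor P Ω V lam u x := by
  have h1 := Lp.coeFn_smul c (minOp P Ω u)
  have h2 := Lp.coeFn_smul c (u : L2 Ω)
  filter_upwards [h1, h2] with x h1 h2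
  simp only [innerFactor, LinearPMap.map_smul, Submodule.coe_smul, h1, h2, Pi.smul_apply,
    smul_eq_mul]
  ring

theorem WeakSol.congr {n : ℕ} {P : MvPolynomial (Fin n) ℝ} {Ω : Opens (Space n)}
    {V : Space n → ℝ} {lam : ℂ} {g g' : Space n → ℂ} (h : WeakSol P Ω V lam g)
    (hg : g' =ᵐ[volume.restrict (Ω : Set (Space n))] g) : WeakSol P Ω V lam g' := by
  intro φ
  have e := hg.mul (EventuallyEq.refl _ (fun x => starRingEnd ℂ
      (polyOp P Ω φ x + (V x : ℂ) * φ x - starRingEnd ℂ lam * φ x)))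
  exact ⟨(h φ).1.congr e.symm, (integral_congr_ae e).trans (h φ).2⟩

theorem WeakSol.add {n : ℕ} {P : MvPolynomial (Fin n) ℝ} {Ω : Opens (Space n)}
    {V : Space n → ℝ} {lam : ℂ} {g g' : Space n → ℂ} (h : WeakSol P Ω V lam g)
    (h' : WeakSol P Ω V lam g') : WeakSol P Ω V lam (fun x => g x + g' x) := by
  intro φ
  simp only [add_mul]
  exact ⟨(h φ).1.add (h' φ).1, by rw [integral_add (h φ).1 (h' φ).1, (h φ).2, (h' φ).2, add_zero]⟩

theorem WeakSol.smul {n : ℕ} {P : MvPolynomial (Fin n) ℝ} {Ω : Opens (Space n)}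
    {V : Space n → ℝ} {lam : ℂ} {g : Space n → ℂ} (c : ℂ) (h : WeakSol P Ω V lam g) :
    WeakSol P Ω V lam (fun x => c * g x) := by
  intro φ
  simp only [mul_assoc]
  exact ⟨(h φ).1.const_mul c, by rw [integral_const_mul, (h φ).2, mul_zero]⟩

/-- The kernel of `T_lam = (P₀ + V - lam) (1/V) (P₀ - lam)`: all `u ∈ H₀^{P₀}(Ω)` with
`T_lam u = 0` in `𝓓'(Ω)`. Such `u` automatically lie in the operator domain
`{u ∈ H₀^{P₀}(Ω) : P₀ ((1/V) P₀ - lam/V) u ∈ L²(Ω)}` of `T_lam`. -/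
def kerT {n : ℕ} (P : MvPolynomial (Fin n) ℝ) (Ω : Opens (Space n)) (V : Space n → ℝ)
    (lam : ℂ) : Submodule ℂ (H0 P Ω) where
  carrier := {u | WeakSol P Ω V lam (innerFactor P Ω V lam u)}
  zero_mem' := by
    have h : innerFactor P Ω V lam 0 =ᵐ[volume.restrict (Ω : Set (Space n))] fun _ => 0 := by
      have := innerFactor_smul P Ω V lam 0 0
      simpa using this
    exact WeakSol.congr (fun φ => by simp) h
  add_mem' hu hu' := (hu.add hu').congr (innerFactor_add P Ω V lam _ _)
  smul_mem' c _ hu := (hu.smul c).congr (innerFactor_smul P Ω V lam c _)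

/-- The multiplicity of the (real) transmission eigenvalue `lam`: the multiplicity of `0` as an
eigenvalue of the self-adjoint operator `T_lam`, i.e. the dimension of its kernel. -/
def multiplicity {n : ℕ} (P : MvPolynomial (Fin n) ℝ) (Ω : Opens (Space n)) (V : Space n → ℝ)
    (lam : ℝ) : ℕ :=
  Module.finrank ℂ (kerT P Ω V (lam : ℂ))

/-- The support of (the distribution given by) an almost everywhere defined function: the
complement of the largest open set on which it vanishes almost everywhere. -/
def essSupport {n : ℕ} (V : Space n → ℝ) : Set (Space n) :=
  {x | ∀ U ∈ 𝓝 x, ¬ ∀ᵐ y ∂(volume.restrict U), V y = 0}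

end

end TransmissionProblem

/-! Pairing $T_\lambda u$ with $u$ gives, for real $\lambda$, the form $q_\lambda(u)=\langle
V^{-1}(P_0-\lambda)u,(P_0-\lambda)u\rangle+\langle(P_0-\lambda)u,u\rangle$. On $H_0^{P_0}(\Omega)$
with the graph norm it is represented by a bounded self-adjoint operator `formOp`, norm continuous
in $\lambda$, whose kernel is $\ker T_\lambda$ (`mem_kerT_iff`). The real eigenvalues are found by
counting how many negative directions $q_\lambda$ acquires along a path of $\lambda$.

At one end $q_\lambda$ is positive: far to the left if $P_0$ is bounded below, far to the right if
$-P_0$ is. At $\lambda=\delta/2$ the bound $V^{-1}\le\delta^{-1}$ yields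
$q_{\delta/2}(u)\le\delta^{-1}\|P_0u\|^2-\tfrac{\delta}{4}\|u\|^2$, which is nonpositive on the
given $p$-dimensional space (`formOp_nonpos`). As $\widetilde P_0\to\infty$, the embedding into
$L^2(\Omega)$ is compact (`exists_finite_rank_estimate`), so each $q_\lambda$ is coercive up to a
finite rank term. Hence its index is finite and can change only where there is a kernel, by at most
the dimension of that kernel (`exists_kernels_of_path`). No monotonicity in $\lambda$ is needed.

A nonzero $u\in\ker T_\lambda$ gives the eigenfunctions $w=V^{-1}(P_0-\lambda)u$ and $v=w+u$. If
either vanished, then $|(P_0-\lambda)u|\le M|u|$ with $u\in H_0^{P_0}(\Omega)$. This forces $u=0$ by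
a Carleman estimate with weight $e^{\tau x_j}$ (`eq_zero_of_mem_minGraph_of_norm_le`). Both the
Carleman estimate and the compactness rest on Hörmander's inequality $\|(\partial_jQ)(D)\varphi\|\le
C\|Q(D)\varphi\|$ on bounded domains. -/

section SpectralFlow

/-! ### Index and kernels of a path of self-adjoint operators -/

variable {H : Type*} [NormedAddCommGroup H] [InnerProductSpace ℂ H]

theorem re_inner_add_smul {A : H →L[ℂ] H} (hA : ∀ x y, inner ℂ (A x) y = inner ℂ x (A y))
    (x y : H) (c : ℂ) :
    (inner ℂ (A (x + c • y)) (x + c • y)).re =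
      (inner ℂ (A x) x).re + 2 * (c * inner ℂ (A x) y).re + ‖c‖ ^ 2 * (inner ℂ (A y) y).re := by
  have h1 : inner ℂ (A y) x = starRingEnd ℂ (inner ℂ (A x) y) := by
    rw [inner_conj_symm, hA]
  have h2 : ‖c‖ ^ 2 = c.re * c.re + c.im * c.im := by
    rw [← Complex.normSq_eq_norm_sq, Complex.normSq_apply]
  simp only [map_add, map_smul, inner_add_left, inner_add_right, inner_smul_left,
    inner_smul_right, h1, h2, Complex.add_re, Complex.add_im, Complex.mul_re, Complex.mul_im,
    Complex.conj_re, Complex.conj_im]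
  ring

theorem re_inner_parallelogram (A : H →L[ℂ] H) (x y : H) :
    (inner ℂ (A (x - y)) (x - y)).re + (inner ℂ (A (x + y)) (x + y)).re =
      2 * (inner ℂ (A x) x).re + 2 * (inner ℂ (A y) y).re := by
  simp only [map_add, map_sub, inner_add_left, inner_add_right, inner_sub_left, inner_sub_right,
    Complex.add_re, Complex.sub_re]
  ring

/-- Cauchy–Schwarz for a semidefinite form: moving from `y` a short way along `-conj a • z` would
make the form negative unless `a = 0`. The step length `1 / (b + 1)` keeps the quadratic term below
the linear one. -/
theorem inner_eq_zero_of_nonneg_on {A : H →L[ℂ] H}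
    (hA : ∀ x y, inner ℂ (A x) y = inner ℂ x (A y)) {Y : Submodule ℂ H}
    (hY : ∀ u ∈ Y, 0 ≤ (inner ℂ (A u) u).re) {y : H} (hy : y ∈ Y)
    (hy0 : (inner ℂ (A y) y).re = 0) {z : H} (hz : z ∈ Y) : inner ℂ (A y) z = 0 := by
  set a := inner ℂ (A y) z with ha
  set b := (inner ℂ (A z) z).re with hb
  have hb0 : 0 ≤ b := hY z hz
  set t : ℝ := 1 / (b + 1) with ht
  have htp : 0 < t := by positivity
  have h := hY _ (Y.add_mem hy (Y.smul_mem (-(t : ℂ) * starRingEnd ℂ a) hz))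
  rw [re_inner_add_smul hA, hy0, ← ha, ← hb, norm_mul, norm_neg, Complex.norm_real,
    RCLike.norm_conj, mul_pow, Real.norm_eq_abs, sq_abs, mul_assoc, mul_comm (starRingEnd ℂ a),
    Complex.mul_conj, ← Complex.ofReal_neg, ← Complex.ofReal_mul, Complex.ofReal_re,
    Complex.normSq_eq_norm_sq] at h
  have h3 : t * b < 1 := by
    rw [ht, one_div_mul_eq_div, div_lt_one (by positivity)]; linarith
  by_contra hne
  have : 0 < ‖a‖ ^ 2 := by positivity
  nlinarith [mul_pos htp this]

/-- Otherwise there are unit vectors whose form values tend to 0. The finite rank images `T u`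
converge along a subsequence, and the parallelogram law then makes the subsequence itself Cauchy.
Its limit is a unit vector of `Y` with zero form value. -/
theorem exists_coercive_of_pos [CompleteSpace H] {A : H →L[ℂ] H}
    {F : Type*} [NormedAddCommGroup F] [NormedSpace ℂ F] [FiniteDimensional ℂ F]
    (T : H →L[ℂ] F) {c : ℝ} (hc : 0 < c)
    {Y : Submodule ℂ H} (hT : ∀ u ∈ Y, c * ‖u‖ ^ 2 ≤ (inner ℂ (A u) u).re + ‖T u‖ ^ 2)
    (hYc : IsClosed (Y : Set H))
    (hY : ∀ u ∈ Y, u ≠ 0 → 0 < (inner ℂ (A u) u).re) :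
    ∃ γ > 0, ∀ u ∈ Y, γ * ‖u‖ ^ 2 ≤ (inner ℂ (A u) u).re := by
  by_contra! hcon
  have hY0 : ∀ u ∈ Y, 0 ≤ (inner ℂ (A u) u).re := fun u hu => by
    rcases eq_or_ne u 0 with rfl | h
    · simp
    · exact (hY u hu h).le
  have hex : ∀ k : ℕ, ∃ u ∈ Y, ‖u‖ = 1 ∧ (inner ℂ (A u) u).re < 1 / ((k : ℝ) + 1) := by
    intro k
    obtain ⟨u, hu, h⟩ := hcon (1 / ((k : ℝ) + 1)) (by positivity)
    have hu0 : u ≠ 0 := by rintro rfl; simp at h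
    have hn : 0 < ‖u‖ := norm_pos_iff.2 hu0
    refine ⟨((‖u‖⁻¹ : ℝ) : ℂ) • u, Y.smul_mem _ hu, ?_, ?_⟩
    · rw [norm_smul, Complex.norm_real, norm_inv, norm_norm, inv_mul_cancel₀ hn.ne']
    · rw [map_smul, inner_smul_left, inner_smul_right, Complex.conj_ofReal, ← mul_assoc,
        ← Complex.ofReal_mul, Complex.re_ofReal_mul]
      calc _ < ‖u‖⁻¹ * ‖u‖⁻¹ * (1 / ((k : ℝ) + 1) * ‖u‖ ^ 2) := by gcongr
        _ = _ := by field_simp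
  choose u huY hu1 huq using hex
  obtain ⟨t, φ, hφ, ht⟩ : ∃ t, ∃ φ : ℕ → ℕ, StrictMono φ ∧
      Tendsto (fun k => T (u (φ k))) atTop (𝓝 t) := by
    have : ProperSpace F := FiniteDimensional.proper ℂ F
    obtain ⟨t, -, φ, hφ, h⟩ := tendsto_subseq_of_bounded
      (Metric.isBounded_closedBall (x := (0 : F)) (r := ‖T‖)) (x := fun k => T (u k)) fun k => by
        rw [mem_closedBall_zero_iff]
        simpa [hu1] using T.le_opNorm (u k)
    exact ⟨t, φ, hφ, h⟩
  have hq0 : Tendsto (fun k => (inner ℂ (A (u (φ k))) (u (φ k))).re) atTop (𝓝 0) := by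
    refine squeeze_zero (fun k => hY0 _ (huY _)) (fun k => (huq (φ k)).le) ?_
    exact (tendsto_one_div_add_atTop_nhds_zero_nat (𝕜 := ℝ)).comp hφ.tendsto_atTop
  have hcau : CauchySeq fun k => u (φ k) := by
    rw [Metric.cauchySeq_iff]
    intro ε hε
    obtain ⟨N1, hN1⟩ := Metric.cauchySeq_iff.1 ht.cauchySeq (Real.sqrt (c * ε ^ 2 / 2))
      (by positivity)
    obtain ⟨N2, hN2⟩ := Filter.eventually_atTop.1
      (hq0.eventually (gt_mem_nhds (show (0 : ℝ) < c * ε ^ 2 / 8 by positivity)))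
    refine ⟨max N1 N2, fun k hk l hl => ?_⟩
    have e1 := hN1 k ((le_max_left _ _).trans hk) l ((le_max_left _ _).trans hl)
    have e2 := hN2 k ((le_max_right _ _).trans hk)
    have e3 := hN2 l ((le_max_right _ _).trans hl)
    rw [dist_eq_norm, ← map_sub] at e1
    have e4 := (Real.lt_sqrt (norm_nonneg _)).1 e1
    have e5 := hT _ (Y.sub_mem (huY (φ k)) (huY (φ l)))
    have e6 := re_inner_parallelogram A (u (φ k)) (u (φ l))
    have e7 := hY0 _ (Y.add_mem (huY (φ k)) (huY (φ l)))
    rw [dist_eq_norm]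
    refine lt_of_pow_lt_pow_left₀ 2 hε.le ?_
    -- The sum term in the parallelogram law is nonnegative, so the difference costs less than `4 *
    -- (c ε² / 8)` from the form and less than `c ε² / 2` from `T`.
    have : c * ‖u (φ k) - u (φ l)‖ ^ 2 < c * ε ^ 2 := by linarith
    exact lt_of_mul_lt_mul_left this hc.le
  obtain ⟨v, hv⟩ := cauchySeq_tendsto_of_complete hcau
  have hvY : v ∈ Y := hYc.mem_of_tendsto hv (Eventually.of_forall fun k => huY _)
  have hv1 : ‖v‖ = 1 := tendsto_nhds_unique hv.norm (by simp [hu1])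
  have hvq : (inner ℂ (A v) v).re = 0 := by
    refine tendsto_nhds_unique ?_ hq0
    have : Continuous fun v => (inner ℂ (A v) v).re :=
      Complex.continuous_re.comp (A.continuous.inner continuous_id)
    exact (this.tendsto v).comp hv
  have := hY v hvY (by rintro rfl; simp at hv1)
  linarith

theorem finrank_le_of_injOn {M : Type*} [AddCommGroup M] [Module ℂ M] [FiniteDimensional ℂ M]
    {F : Submodule ℂ H} (T : H →ₗ[ℂ] M) (h : ∀ u ∈ F, T u = 0 → u = 0) :
    FiniteDimensional ℂ F ∧ Module.finrank ℂ F ≤ Module.finrank ℂ M := by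
  have hi : Function.Injective (T.comp F.subtype) := by
    rw [← LinearMap.ker_eq_bot, LinearMap.ker_eq_bot']
    intro u hu
    exact Subtype.ext (h u u.2 hu)
  exact ⟨Module.Finite.of_injective _ hi, LinearMap.finrank_le_finrank_of_injective hi⟩

/-- Splitting of a self-adjoint operator which is bounded below modulo finite rank: a negative
definite part `E`, the kernel, and a part `Y` on which the form is coercive. -/
theorem exists_inertia_splitting [CompleteSpace H] {A : H →L[ℂ] H}
    (hA : ∀ x y, inner ℂ (A x) y = inner ℂ x (A y))
    {F : Type*} [NormedAddCommGroup F] [NormedSpace ℂ F] [FiniteDimensional ℂ F]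
    (T : H →L[ℂ] F) {c : ℝ} (hc : 0 < c)
    (hT : ∀ u, c * ‖u‖ ^ 2 ≤ (inner ℂ (A u) u).re + ‖T u‖ ^ 2) :
    ∃ (E Y : Submodule ℂ H) (γ : ℝ), 0 < γ ∧ FiniteDimensional ℂ E ∧
      (∀ u ∈ E, u ≠ 0 → (inner ℂ (A u) u).re < 0) ∧
      (∀ u ∈ Y, γ * ‖u‖ ^ 2 ≤ (inner ℂ (A u) u).re) ∧
      ∀ G : Submodule ℂ H, (∀ u ∈ G, u ∈ Y → u = 0) →
        Module.finrank ℂ G ≤ Module.finrank ℂ E + Module.finrank ℂ A.ker := by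
  -- Every subspace on which the form is nonpositive embeds into `F` through `T`; this bounds the
  -- index and the kernel.
  have hinj : ∀ u, (inner ℂ (A u) u).re ≤ 0 → T u = 0 → u = 0 := by
    intro u hu h0
    have := hT u
    rw [h0, norm_zero] at this
    have h2 : ‖u‖ ^ 2 ≤ 0 := by nlinarith
    simpa using h2
  have hneg : ∀ E : Submodule ℂ H, (∀ u ∈ E, u ≠ 0 → (inner ℂ (A u) u).re < 0) →
      FiniteDimensional ℂ E ∧ Module.finrank ℂ E ≤ Module.finrank ℂ F := fun E hE =>
    finrank_le_of_injOn (T : H →ₗ[ℂ] F) fun u hu h0 => by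
      by_contra hne
      exact hne (hinj u (hE u hu hne).le h0)
  obtain ⟨E, hE, hmax⟩ : ∃ E : Submodule ℂ H, (∀ u ∈ E, u ≠ 0 → (inner ℂ (A u) u).re < 0) ∧
      ∀ E' : Submodule ℂ H, (∀ u ∈ E', u ≠ 0 → (inner ℂ (A u) u).re < 0) →
        Module.finrank ℂ E' ≤ Module.finrank ℂ E := by
    classical
    let S : Set ℕ := {k | ∃ E : Submodule ℂ H, (∀ u ∈ E, u ≠ 0 → (inner ℂ (A u) u).re < 0) ∧
      Module.finrank ℂ E = k}
    have hS : S.Nonempty := ⟨_, ⊥, fun u hu h => (h ((Submodule.mem_bot ℂ).1 hu)).elim, rfl⟩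
    have hSb : BddAbove S := ⟨Module.finrank ℂ F, by rintro _ ⟨E, hE, rfl⟩; exact (hneg E hE).2⟩
    obtain ⟨E, hE, hEk⟩ := Nat.sSup_mem hS hSb
    exact ⟨E, hE, fun E' hE' => hEk ▸ le_csSup hSb ⟨E', hE', rfl⟩⟩
  have := (hneg E hE).1
  set N : Submodule ℂ H := A.ker with hN
  have hNfin : FiniteDimensional ℂ N :=
    (finrank_le_of_injOn (T : H →ₗ[ℂ] F) fun u hu h0 => hinj u (by
      rw [show A u = 0 from hu]; simp) h0).1
  have := hNfin
  -- The complement of `E` with respect to the form, not the inner product.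
  set X : Submodule ℂ H := Eᗮ.comap (A : H →ₗ[ℂ] H) with hX
  have hXE : ∀ u ∈ X, ∀ e ∈ E, inner ℂ (A u) e = 0 := fun u hu e he =>
    Submodule.inner_left_of_mem_orthogonal he hu
  have hXnn : ∀ y ∈ X, 0 ≤ (inner ℂ (A y) y).re := by
    intro y hy
    by_contra! hlt
    have hyE : y ∉ E := fun h => by rw [hXE y hy y h] at hlt; simp at hlt
    -- `E` and `y` are orthogonal for the form, so a negative `y` would enlarge the maximal negative
    -- space.
    have hbig := hmax (E ⊔ ℂ ∙ y) (by
      intro u hu hu0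
      obtain ⟨e, he, z, hz, rfl⟩ := Submodule.mem_sup.1 hu
      obtain ⟨c, rfl⟩ := Submodule.mem_span_singleton.1 hz
      rw [re_inner_add_smul hA]
      have h0 : inner ℂ (A e) y = 0 := by
        rw [hA, ← inner_conj_symm, hXE y hy e he, map_zero]
      rw [h0, mul_zero, Complex.zero_re, mul_zero, add_zero]
      rcases eq_or_ne e 0 with rfl | he0
      · have hc0 : c ≠ 0 := by rintro rfl; simp at hu0
        have : 0 < ‖c‖ ^ 2 := by positivity
        simp only [map_zero, inner_zero_left, Complex.zero_re, zero_add]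
        exact mul_neg_of_pos_of_neg this hlt
      · have := hE e he he0
        nlinarith [sq_nonneg ‖c‖])
    have hlt' : E < E ⊔ ℂ ∙ y := by
      refine lt_of_le_of_ne le_sup_left fun h => hyE ?_
      rw [h]
      exact (le_sup_right : ℂ ∙ y ≤ _) (Submodule.mem_span_singleton_self y)
    exact absurd (Submodule.finrank_lt_finrank_of_lt hlt') (not_lt.2 hbig)
  -- The compression of `A` to `E` is injective by definiteness, hence bijective in finite
  -- dimension; solving with it removes the `E`-part of any `x`.
  have hdecomp : ∀ x : H, ∃ e ∈ E, x - e ∈ X := by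
    let B : E →ₗ[ℂ] E := (E.orthogonalProjectionOnto.toLinearMap.comp (A : H →ₗ[ℂ] H)).comp
      E.subtype
    have hB : Function.Injective B := by
      rw [← LinearMap.ker_eq_bot, LinearMap.ker_eq_bot']
      intro e he
      have h1 : A e ∈ Eᗮ := by
        rw [← Submodule.orthogonalProjectionOnto_eq_zero_iff]; exact he
      by_contra hne
      have h2 := hE e e.2 (fun h => hne (Subtype.ext h))
      rw [hXE (e : H) h1 e e.2] at h2
      simp at h2
    intro x
    obtain ⟨e, he⟩ := LinearMap.injective_iff_surjective.1 hB (E.orthogonalProjectionOnto (A x))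
    refine ⟨e, e.2, ?_⟩
    change A (x - e) ∈ Eᗮ
    rw [← Submodule.orthogonalProjectionOnto_eq_zero_iff, map_sub, map_sub, sub_eq_zero]
    exact he.symm
  have hYpos : ∀ u ∈ X ⊓ Nᗮ, u ≠ 0 → 0 < (inner ℂ (A u) u).re := by
    intro y hy hy0
    refine lt_of_le_of_ne (hXnn y hy.1) fun h => hy0 ?_
    -- A null vector of the semidefinite form on `X` is annihilated by pairing with `X`, and with
    -- `E` by definition of `X`; together these span `H`.
    have hAy : A y = 0 := by
      refine ext_inner_right ℂ fun x => ?_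
      obtain ⟨e, he, hx⟩ := hdecomp x
      rw [inner_zero_left, ← add_sub_cancel e x, inner_add_right, hXE y hy.1 e he,
        inner_eq_zero_of_nonneg_on hA hXnn hy.1 h.symm hx, add_zero]
    have : inner ℂ y y = 0 := Submodule.inner_right_of_mem_orthogonal (K := N) hAy hy.2
    exact inner_self_eq_zero.1 this
  have hYc : IsClosed ((X ⊓ Nᗮ : Submodule ℂ H) : Set H) := by
    rw [Submodule.coe_inf]
    exact (E.isClosed_orthogonal.preimage A.continuous).inter N.isClosed_orthogonal
  obtain ⟨γ, hγ, hYγ⟩ := exists_coercive_of_pos T hc (fun u _ => hT u) hYc hYpos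
  refine ⟨E, X ⊓ Nᗮ, γ, hγ, (hneg E hE).1, hE, hYγ, fun G hG => ?_⟩
  -- The map `u ↦ (proj_E (A u), proj_N u)` has kernel exactly `Y`, which bounds the codimension of
  -- `Y`.
  have := (finrank_le_of_injOn (F := G) ((E.orthogonalProjectionOnto.toLinearMap.comp
    (A : H →ₗ[ℂ] H)).prod N.orthogonalProjectionOnto.toLinearMap) fun u hu h0 => hG u hu ?_).2
  · rwa [Module.finrank_prod] at this
  · have h1 := congrArg Prod.fst h0
    have h2 := congrArg Prod.snd h0
    exact ⟨(Submodule.orthogonalProjectionOnto_eq_zero_iff).1 h1,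
      (Submodule.orthogonalProjectionOnto_eq_zero_iff).1 h2⟩

theorem re_inner_le_add_norm_sub (A B : H →L[ℂ] H) (u : H) :
    (inner ℂ (A u) u).re ≤ (inner ℂ (B u) u).re + ‖A - B‖ * ‖u‖ ^ 2 := by
  have h : (inner ℂ ((A - B) u) u).re ≤ ‖A - B‖ * ‖u‖ ^ 2 := by
    calc _ ≤ ‖(A - B) u‖ * ‖u‖ := re_inner_le_norm (𝕜 := ℂ) _ _
      _ ≤ ‖A - B‖ * ‖u‖ * ‖u‖ := by gcongr; exact (A - B).le_opNorm u
      _ = _ := by ring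
  rw [sub_apply, inner_sub_left, Complex.sub_re] at h
  linarith

/-- This is `exists_coercive_of_pos` for `-A`. On `E` the projection is the identity, and the factor
`1 + ‖A‖` outweighs the lower bound `-‖A‖` of the form. -/
theorem exists_neg_bound_of_finiteDimensional [CompleteSpace H] {A : H →L[ℂ] H}
    {E : Submodule ℂ H} [FiniteDimensional ℂ E]
    (hE : ∀ u ∈ E, u ≠ 0 → (inner ℂ (A u) u).re < 0) :
    ∃ η > 0, ∀ u ∈ E, (inner ℂ (A u) u).re ≤ -(η * ‖u‖ ^ 2) := by
  have hneg : ∀ u, (inner ℂ ((-A) u) u).re = -(inner ℂ (A u) u).re := fun u => by simp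
  have key : ∀ u ∈ E, 1 * ‖u‖ ^ 2 ≤ (inner ℂ ((-A) u) u).re +
      ‖((((1 + ‖A‖ : ℝ) : ℂ)) • E.orthogonalProjectionOnto) u‖ ^ 2 := by
    intro u hu
    have h1 := re_inner_le_add_norm_sub A 0 u
    have h2 : ‖E.orthogonalProjectionOnto u‖ = ‖u‖ := by
      rw [Submodule.orthogonalProjectionOnto_mem_subspace_eq_self (⟨u, hu⟩ : E)]; rfl
    rw [hneg, smul_apply, norm_smul, h2, Complex.norm_real, mul_pow,
      Real.norm_of_nonneg (by positivity)]
    simp only [zero_apply, inner_zero_left, Complex.zero_re, sub_zero,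
      zero_add] at h1
    nlinarith [norm_nonneg A, sq_nonneg ‖u‖, mul_nonneg (norm_nonneg A) (sq_nonneg ‖u‖),
      mul_nonneg (sq_nonneg ‖A‖) (sq_nonneg ‖u‖)]
  obtain ⟨η, hη, h⟩ := exists_coercive_of_pos (A := -A) _ one_pos key
    E.closed_of_finiteDimensional (fun u hu h0 => by rw [hneg]; linarith [hE u hu h0])
  exact ⟨η, hη, fun u hu => by have := h u hu; rw [hneg] at this; linarith⟩

/-- Along a continuous path of self-adjoint operators, bounded below modulo finite rank, which
starts at a positive operator and ends at one that is nonpositive on a `p`-dimensional space,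
the kernels have total dimension at least `p`. -/
theorem exists_kernels_of_path [CompleteSpace H] {A : ℝ → H →L[ℂ] H} (hAc : Continuous A)
    (hA : ∀ l x y, inner ℂ (A l x) y = inner ℂ x (A l y))
    (hT : ∀ l, ∃ (k : ℕ) (T : H →L[ℂ] EuclideanSpace ℂ (Fin k)) (c : ℝ), 0 < c ∧
      ∀ u, c * ‖u‖ ^ 2 ≤ (inner ℂ (A l u) u).re + ‖T u‖ ^ 2)
    {a b : ℝ} (hab : a ≤ b) (ha : ∀ u, u ≠ 0 → 0 < (inner ℂ (A a u) u).re)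
    {p : ℕ} {W : Submodule ℂ H} (hWp : Module.finrank ℂ W = p)
    (hW : ∀ u ∈ W, (inner ℂ (A b u) u).re ≤ 0) :
    ∃ ev : Fin p → ℝ, ∀ i, (Finset.univ.filter fun j => ev j = ev i).card ≤
      Module.finrank ℂ (A (ev i)).ker := by
  -- The `k`-th eigenvalue will be `sInf (S k)`, the first parameter with a `k`-dimensional
  -- nonpositive space. For `k ≥ 1` the inequality on `finrank` also excludes infinite-dimensional
  -- `F`, whose `finrank` is 0.
  let S : ℕ → Set ℝ := fun k => {l | l ∈ Icc a b ∧ ∃ F : Submodule ℂ H,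
    k ≤ Module.finrank ℂ F ∧ ∀ u ∈ F, (inner ℂ (A l u) u).re ≤ 0}
  -- With `e` the negative index at `l`, every `k` whose first parameter is `l` satisfies `e < k ≤ e
  -- + dim ker`, so at most `dim ker` indices share the value `l`.
  have hdim : ∀ l, ∃ e : ℕ, (∀ k ∈ Finset.Ioc 0 p, l = sInf (S k) →
      k ∈ Finset.Ioc e (e + Module.finrank ℂ (A l).ker)) := by
    intro l
    obtain ⟨m, T, c, hc, hTl⟩ := hT l
    obtain ⟨E, Y, γ, hγ, hEf, hE, hY, hG⟩ := exists_inertia_splitting (hA l) T hc hTl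
    refine ⟨Module.finrank ℂ E, fun k hk hl => ?_⟩
    rw [Finset.mem_Ioc] at hk ⊢
    have hSne : (S k).Nonempty := ⟨b, ⟨hab, le_rfl⟩, W, hWp ▸ hk.2, hW⟩
    have hSb : BddBelow (S k) := ⟨a, fun x hx => hx.1.1⟩
    have hle : k ≤ Module.finrank ℂ E + Module.finrank ℂ (A l).ker := by
      -- Near `l` the form stays positive on `Y`, so a nonpositive space at a nearby `l' ∈ S k`
      -- meets `Y` only in 0.
      obtain ⟨l', hl', hd⟩ : ∃ l' ∈ S k, ‖A l' - A l‖ < γ := by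
        have h1 : l ∈ closure (S k) := hl ▸ csInf_mem_closure hSne hSb
        have h2 : {l' | ‖A l' - A l‖ < γ} ∈ 𝓝 l := by
          have := (hAc.tendsto l).eventually (Metric.ball_mem_nhds (A l) hγ)
          filter_upwards [this] with x hx
          rwa [dist_eq_norm] at hx
        obtain ⟨l', h3, h4⟩ := mem_closure_iff_nhds.1 h1 _ h2
        exact ⟨l', h4, h3⟩
      obtain ⟨-, F, hF, hFq⟩ := hl'
      refine hF.trans (hG F fun u hu huY => ?_)
      have h1 := hY u huY
      have h2 := re_inner_le_add_norm_sub (A l) (A l') u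
      rw [norm_sub_rev] at h2
      have h3 := hFq u hu
      have h4 : ‖u‖ ^ 2 ≤ 0 := by nlinarith
      simpa using h4
    refine ⟨?_, hle⟩
    -- If `k ≤ e`, the negative space `E` survives for parameters slightly left of `l`,
    -- contradicting the infimum; positivity at `a` leaves room on the left.
    by_contra! hkE
    have hlS : l ∈ Icc a b := by
      constructor
      · rw [hl]; exact le_csInf hSne fun x hx => hx.1.1
      · rw [hl]; exact (csInf_le hSb ⟨⟨hab, le_rfl⟩, W, hWp ▸ hk.2, hW⟩)
    have hal : a < l := by
      refine lt_of_le_of_ne hlS.1 fun h => ?_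
      have hnt : 0 < Module.finrank ℂ E := lt_of_lt_of_le hk.1 hkE
      have := Module.nontrivial_of_finrank_pos hnt
      obtain ⟨u, hu⟩ := exists_ne (0 : E)
      have hu0 : (u : H) ≠ 0 := fun h => hu (Subtype.ext h)
      have h1 := hE u u.2 hu0
      rw [← h] at h1
      exact lt_asymm h1 (ha u hu0)
    obtain ⟨η, hη, hEη⟩ := exists_neg_bound_of_finiteDimensional hE
    have h2 : {l' | ‖A l' - A l‖ < η} ∈ 𝓝 l := by
      have := (hAc.tendsto l).eventually (Metric.ball_mem_nhds (A l) hη)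
      filter_upwards [this] with x hx
      rwa [dist_eq_norm] at hx
    obtain ⟨l', hl'1, hl'2, hl'3⟩ := Filter.nonempty_of_mem
      (inter_mem (mem_nhdsWithin_of_mem_nhds h2) (Ioo_mem_nhdsLT hal))
    have : l' ∈ S k := by
      refine ⟨⟨hl'2.le, hl'3.le.trans hlS.2⟩, E, hkE, fun u hu => ?_⟩
      have h3 := re_inner_le_add_norm_sub (A l') (A l) u
      have h4 := hEη u hu
      have h5 : ‖A l' - A l‖ * ‖u‖ ^ 2 ≤ η * ‖u‖ ^ 2 := by
        gcongr; exact le_of_lt hl'1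
      linarith
    exact absurd (csInf_le hSb this) (not_le.2 (hl ▸ hl'3))
  -- The shift by one makes the indices run over `1, …, p`; `S 0` contains every parameter.
  refine ⟨fun i => sInf (S (i + 1)), fun i => ?_⟩
  obtain ⟨e, he⟩ := hdim (sInf (S (i + 1)))
  dsimp only
  refine (Finset.card_le_card_of_injOn
    (t := Finset.Ioc e (e + Module.finrank ℂ (A (sInf (S (i + 1)))).ker))
    (fun j : Fin p => (j : ℕ) + 1) (fun j hj => ?_)
    (fun x _ y _ h => Fin.ext (by simpa using h))).trans_eq (by simp)
  exact he _ (Finset.mem_Ioc.2 ⟨j.val.succ_pos, j.isLt⟩) ((Finset.mem_filter.1 hj).2).symm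

end SpectralFlow

namespace TransmissionProblem

noncomputable section

/-! ### The algebra of constant-coefficient operators on test functions -/

variable {n : ℕ} {Ω : Opens (Space n)}

/-- Multiplication by a smooth function, acting on `C₀^∞(Ω)`. -/
def mulOp (Ω : Opens (Space n)) {a : Space n → ℂ} (ha : ContDiff ℝ (⊤ : ℕ∞) a) :
    Module.End ℂ 𝓓(Ω, ℂ) where
  toFun φ := ⟨fun x => a x * φ x, ha.mul φ.contDiff, φ.hasCompactSupport.mul_left,
    (closure_mono (Function.support_mul_subset_right a φ)).trans φ.tsupport_subset⟩
  map_add' φ ψ := by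
    ext x; exact mul_add _ _ _
  map_smul' c φ := by
    ext x; exact mul_left_comm _ _ _

theorem mulOp_apply {a : Space n → ℂ} (ha : ContDiff ℝ (⊤ : ℕ∞) a) (φ : 𝓓(Ω, ℂ)) (x : Space n) :
    mulOp Ω ha φ x = a x * φ x := rfl

theorem add_testFunction_apply (φ ψ : 𝓓(Ω, ℂ)) (x : Space n) : (φ + ψ) x = φ x + ψ x := rfl

theorem smul_testFunction_apply (c : ℂ) (φ : 𝓓(Ω, ℂ)) (x : Space n) : (c • φ) x = c * φ x := rfl

theorem differentiable_testFunction (φ : 𝓓(Ω, ℂ)) : Differentiable ℝ φ :=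
  φ.contDiff.differentiable (by simp)

theorem dOp_mulOp {a b : Space n → ℂ} (ha : ContDiff ℝ (⊤ : ℕ∞) a) (hb : ContDiff ℝ (⊤ : ℕ∞) b)
    {k : Fin n}
    (hab : ∀ x, b x = -Complex.I * fderiv ℝ a x (EuclideanSpace.single k (1 : ℝ)))
    (φ : 𝓓(Ω, ℂ)) :
    dOp Ω k (mulOp Ω ha φ) = mulOp Ω ha (dOp Ω k φ) + mulOp Ω hb φ := by
  ext x
  have h : fderiv ℝ (mulOp Ω ha φ) x = a x • fderiv ℝ φ x + φ x • fderiv ℝ a x :=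
    fderiv_mul ((ha.differentiable (by simp)) x) (differentiable_testFunction φ x)
  rw [dOp_apply, h, add_testFunction_apply, mulOp_apply, mulOp_apply, dOp_apply, hab]
  simp only [add_apply, smul_apply, smul_eq_mul]
  ring

theorem dOp_comm (i j : Fin n) : dOp Ω i * dOp Ω j = dOp Ω j * dOp Ω i := by
  have key : ∀ (i j : Fin n) (φ : 𝓓(Ω, ℂ)) (x : Space n), dOp Ω i (dOp Ω j φ) x =
      -(fderiv ℝ (fderiv ℝ φ) x (EuclideanSpace.single i (1 : ℝ))
        (EuclideanSpace.single j (1 : ℝ))) := by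
    intro i j φ x
    have hd : DifferentiableAt ℝ (fderiv ℝ φ) x :=
      ((φ.contDiff.fderiv_right (m := 1) (WithTop.coe_le_coe.2 le_top)).differentiable (by simp)) x
    have h1 : (dOp Ω j φ : Space n → ℂ) = fun y =>
        -Complex.I * fderiv ℝ φ y (EuclideanSpace.single j (1 : ℝ)) := funext (dOp_apply j φ)
    rw [dOp_apply, h1, fderiv_const_mul (hd.clm_apply (differentiableAt_const _)),
      fderiv_clm_apply hd (differentiableAt_const _)]
    simp only [smul_apply, add_apply, smul_eq_mul, ContinuousLinearMap.flip_apply,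
      ContinuousLinearMap.comp_apply, fderiv_const_apply, zero_apply, map_zero, zero_add]
    rw [← mul_assoc, neg_mul_neg, Complex.I_mul_I, neg_one_mul]
  ext φ x
  rw [Module.End.mul_apply, Module.End.mul_apply, key, key]
  congr 1
  have hs : IsSymmSndFDerivAt ℝ φ x :=
    φ.contDiff.contDiffAt.isSymmSndFDerivAt
      (by simpa using WithTop.coe_le_coe.2 (le_top (a := (2 : ℕ∞))))
  exact hs _ _

/-- `Q(D)` for a complex polynomial `Q`, as a homomorphism of algebras. -/
def opHom (Ω : Opens (Space n)) : MvPolynomial (Fin n) ℂ →ₐ[ℂ] Module.End ℂ 𝓓(Ω, ℂ) :=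
  -- Evaluation of polynomials needs a commutative target, so it is carried out in the subalgebra
  -- generated by the commuting `D_j`.
  have := Algebra.isMulCommutative_adjoin ℂ (s := range (dOp Ω)) (by
    rintro _ ⟨i, rfl⟩ _ ⟨j, rfl⟩; exact dOp_comm i j)
  letI : CommRing (Algebra.adjoin ℂ (range (dOp Ω))) :=
    { (Algebra.adjoin ℂ (range (dOp Ω))).toRing with mul_comm := mul_comm' }
  (Algebra.adjoin ℂ (range (dOp Ω))).val.comp
    (MvPolynomial.aeval fun j => ⟨dOp Ω j, Algebra.subset_adjoin (mem_range_self j)⟩)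

theorem opHom_X (j : Fin n) : opHom Ω (MvPolynomial.X j) = dOp Ω j := by
  simp [opHom]

theorem opHom_C (c : ℂ) (φ : 𝓓(Ω, ℂ)) : opHom Ω (MvPolynomial.C c) φ = c • φ := by
  rw [← MvPolynomial.algebraMap_eq, AlgHom.commutes]
  rfl

theorem opHom_mul_apply (Q R : MvPolynomial (Fin n) ℂ) (φ : 𝓓(Ω, ℂ)) :
    opHom Ω (Q * R) φ = opHom Ω Q (opHom Ω R φ) := by
  rw [map_mul, Module.End.mul_apply]

/-- A real polynomial with its coefficients regarded as complex numbers. -/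
abbrev toComplex : MvPolynomial (Fin n) ℝ →+* MvPolynomial (Fin n) ℂ :=
  MvPolynomial.map Complex.ofRealHom

theorem polyOp_eq_opHom (P : MvPolynomial (Fin n) ℝ) : polyOp P Ω = opHom Ω (toComplex P) := by
  conv_rhs => rw [P.as_sum]
  rw [polyOp, map_sum, map_sum]
  refine Finset.sum_congr rfl fun α _ => ?_
  have h1 : (MvPolynomial.monomial α (Complex.ofRealHom (P.coeff α)) : MvPolynomial (Fin n) ℂ) =
      ((P.coeff α : ℝ) : ℂ) •
        (List.ofFn fun j => (MvPolynomial.X j : MvPolynomial (Fin n) ℂ) ^ α j).prod := by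
    rw [List.prod_ofFn, MvPolynomial.monomial_eq, MvPolynomial.smul_eq_C_mul,
      Finsupp.prod_fintype _ _ (by simp)]
    rfl
  rw [MvPolynomial.map_monomial, h1, map_smul, map_list_prod, List.map_ofFn, dPow]
  congr 4
  ext1 j
  simp [opHom_X]

theorem norm_mulOp_le {a : Space n → ℂ} (ha : ContDiff ℝ (⊤ : ℕ∞) a) {C : ℝ}
    (hC : ∀ x ∈ Ω, ‖a x‖ ≤ C) (φ : 𝓓(Ω, ℂ)) :
    ‖testToL2 Ω (mulOp Ω ha φ)‖ ≤ C * ‖testToL2 Ω φ‖ := by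
  refine Lp.norm_le_mul_norm_of_ae_le_mul ?_
  filter_upwards [MemLp.coeFn_toLp (memLp_testFunction (mulOp Ω ha φ)),
    MemLp.coeFn_toLp (memLp_testFunction φ), ae_restrict_mem Ω.isOpen.measurableSet]
    with x h1 h2 hx
  change ‖(memLp_testFunction (mulOp Ω ha φ)).toLp _ x‖ ≤ C * ‖(memLp_testFunction φ).toLp _ x‖
  rw [h1, h2, mulOp_apply, norm_mul]
  gcongr
  exact hC x hx

/-- The polynomial with complex conjugate coefficients. -/
abbrev conjPoly : MvPolynomial (Fin n) ℂ →+* MvPolynomial (Fin n) ℂ :=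
  MvPolynomial.map (starRingEnd ℂ)

theorem inner_opHom (Q : MvPolynomial (Fin n) ℂ) (φ ψ : 𝓓(Ω, ℂ)) :
    inner ℂ (testToL2 Ω φ) (testToL2 Ω (opHom Ω Q ψ)) =
      inner ℂ (testToL2 Ω (opHom Ω (conjPoly Q) φ)) (testToL2 Ω ψ) := by
  induction Q using MvPolynomial.induction_on generalizing φ ψ with
  | C c =>
    rw [MvPolynomial.map_C, opHom_C, opHom_C, map_smul, map_smul, inner_smul_left,
      inner_smul_right, Complex.conj_conj]
  | add Q R hQ hR =>
    simp only [map_add, LinearMap.add_apply, inner_add_left, inner_add_right, hQ, hR]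
  | mul_X Q j hQ =>
    rw [opHom_mul_apply, hQ, opHom_X, dOp_symm, map_mul, MvPolynomial.map_X, mul_comm,
      opHom_mul_apply, opHom_X]

theorem conjPoly_conjPoly (Q : MvPolynomial (Fin n) ℂ) : conjPoly (conjPoly Q) = Q := by
  rw [MvPolynomial.map_map]
  convert MvPolynomial.map_id Q
  ext x; simp

/-- The operator `Q(D)` is formally normal: its formal adjoint `conj Q(D)` commutes with it. -/
theorem norm_opHom_conjPoly (Q : MvPolynomial (Fin n) ℂ) (φ : 𝓓(Ω, ℂ)) :
    ‖testToL2 Ω (opHom Ω (conjPoly Q) φ)‖ = ‖testToL2 Ω (opHom Ω Q φ)‖ := by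
  have h : (inner ℂ (testToL2 Ω (opHom Ω (conjPoly Q) φ)) (testToL2 Ω (opHom Ω (conjPoly Q) φ)) : ℂ)
      = inner ℂ (testToL2 Ω (opHom Ω Q φ)) (testToL2 Ω (opHom Ω Q φ)) := by
    have h1 := inner_opHom (conjPoly Q) φ (opHom Ω Q φ)
    rw [conjPoly_conjPoly] at h1
    rw [← inner_opHom, ← h1, ← opHom_mul_apply, ← opHom_mul_apply, mul_comm]
  rw [inner_self_eq_norm_sq_to_K, inner_self_eq_norm_sq_to_K] at h
  have h' : ‖testToL2 Ω (opHom Ω (conjPoly Q) φ)‖ ^ 2 = ‖testToL2 Ω (opHom Ω Q φ)‖ ^ 2 := by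
    exact_mod_cast h
  exact (pow_left_inj₀ (norm_nonneg _) (norm_nonneg _) two_ne_zero).1 h'

/-! ### Commutators with coordinates and Hörmander's inequality -/

theorem contDiff_coord (j : Fin n) : ContDiff ℝ (⊤ : ℕ∞) fun x : Space n => ((x j : ℝ) : ℂ) :=
  Complex.ofRealCLM.contDiff.comp (EuclideanSpace.proj (𝕜 := ℝ) j).contDiff

theorem fderiv_coord (j k : Fin n) (x : Space n) :
    fderiv ℝ (fun x : Space n => ((x j : ℝ) : ℂ)) x (EuclideanSpace.single k (1 : ℝ)) =
      if j = k then 1 else 0 := by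
  have h : HasFDerivAt (fun x : Space n => ((x j : ℝ) : ℂ))
      (Complex.ofRealCLM.comp (EuclideanSpace.proj (𝕜 := ℝ) j)) x :=
    (Complex.ofRealCLM.comp (EuclideanSpace.proj (𝕜 := ℝ) j)).hasFDerivAt
  rw [h.fderiv]
  by_cases hjk : j = k <;> simp [hjk]

/-- Multiplication by the coordinate `x_j`. -/
def coordOp (Ω : Opens (Space n)) (j : Fin n) : Module.End ℂ 𝓓(Ω, ℂ) := mulOp Ω (contDiff_coord j)

theorem dOp_coordOp (j k : Fin n) (φ : 𝓓(Ω, ℂ)) :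
    dOp Ω k (coordOp Ω j φ) = coordOp Ω j (dOp Ω k φ) +
      (-Complex.I * if j = k then 1 else 0) • φ :=
  dOp_mulOp (contDiff_coord j) (contDiff_const (c := -Complex.I * if j = k then 1 else 0))
    (fun x => by rw [fderiv_coord]) φ

/-- `[Q(D), x_j] = -i (∂_j Q)(D)`. -/
theorem opHom_coordOp (j : Fin n) (Q : MvPolynomial (Fin n) ℂ) (φ : 𝓓(Ω, ℂ)) :
    opHom Ω Q (coordOp Ω j φ) = coordOp Ω j (opHom Ω Q φ) +
      (-Complex.I) • opHom Ω (MvPolynomial.pderiv j Q) φ := by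
  induction Q using MvPolynomial.induction_on generalizing φ with
  | C c => simp
  | add Q R hQ hR =>
    simp only [map_add, LinearMap.add_apply, hQ, hR, smul_add]
    abel
  | mul_X Q k hQ =>
    rw [opHom_mul_apply, opHom_X, dOp_coordOp, map_add, hQ, map_smul, opHom_mul_apply, opHom_X,
      Derivation.leibniz, MvPolynomial.pderiv_X, map_add, LinearMap.add_apply, smul_eq_mul,
      smul_eq_mul, mul_comm (MvPolynomial.X k), opHom_mul_apply _ (MvPolynomial.X k), opHom_X]
    by_cases hjk : j = k
    · subst hjk
      simp only [if_true, mul_one, Pi.single_eq_same, smul_add]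
      abel
    · simp [hjk, Ne.symm hjk]

theorem norm_coordOp_le {A : ℝ} (hA : ∀ x ∈ Ω, ‖x‖ ≤ A) (j : Fin n) (φ : 𝓓(Ω, ℂ)) :
    ‖testToL2 Ω (coordOp Ω j φ)‖ ≤ A * ‖testToL2 Ω φ‖ :=
  norm_mulOp_le _ (fun x hx => by
    rw [Complex.norm_real]; exact (PiLp.norm_apply_le x j).trans (hA x hx)) φ

/-- Write `(∂_j Q)(D)` as `i [Q(D), x_j]`, pair with `(∂_j Q)(D) φ`, and use normality to move
`Q(D)` back onto `φ`. What remains involves the second derivative of `Q`, handled by induction. The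
constant depends only on the order in `ξ_j` and the size of `Ω`, which later gives uniformity under
translation of the symbol. -/
theorem norm_opHom_pderiv_le_of_iterate {A : ℝ} (hA : ∀ x ∈ Ω, ‖x‖ ≤ A) (hA0 : 0 ≤ A) (j : Fin n)
    (d : ℕ) (Q : MvPolynomial (Fin n) ℂ) (hQ : (MvPolynomial.pderiv j)^[d + 1] Q = 0)
    (φ : 𝓓(Ω, ℂ)) :
    ‖testToL2 Ω (opHom Ω (MvPolynomial.pderiv j Q) φ)‖ ≤
      2 * d * A * ‖testToL2 Ω (opHom Ω Q φ)‖ := by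
  induction d generalizing Q with
  | zero =>
    have : MvPolynomial.pderiv j Q = 0 := hQ
    simp [this]
  | succ d ih =>
    have h2 := ih (MvPolynomial.pderiv j Q) hQ
    set Q1 := MvPolynomial.pderiv j Q with hQ1
    set Q2 := MvPolynomial.pderiv j Q1 with hQ2
    have e1 : opHom Ω Q1 φ =
        Complex.I • (opHom Ω Q (coordOp Ω j φ) - coordOp Ω j (opHom Ω Q φ)) := by
      rw [opHom_coordOp, add_sub_cancel_left, smul_smul, mul_neg, Complex.I_mul_I, neg_neg,
        one_smul]
    have e2 : inner ℂ (testToL2 Ω (opHom Ω Q1 φ)) (testToL2 Ω (opHom Ω Q (coordOp Ω j φ))) =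
        inner ℂ (testToL2 Ω (opHom Ω (conjPoly Q) φ))
          (testToL2 Ω (opHom Ω (conjPoly Q1) (coordOp Ω j φ))) := by
      have hcc : conjPoly (conjPoly Q1) = Q1 := conjPoly_conjPoly Q1
      rw [inner_opHom, inner_opHom, hcc, ← opHom_mul_apply, ← opHom_mul_apply, mul_comm]
    have e3 : ‖testToL2 Ω (opHom Ω (conjPoly Q1) (coordOp Ω j φ))‖ ≤
        A * ‖testToL2 Ω (opHom Ω Q1 φ)‖ + ‖testToL2 Ω (opHom Ω Q2 φ)‖ := by
      rw [opHom_coordOp, map_add, map_smul, MvPolynomial.pderiv_map]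
      refine (norm_add_le _ _).trans (add_le_add ?_ ?_)
      · exact (norm_coordOp_le hA j _).trans_eq (by rw [norm_opHom_conjPoly])
      · rw [norm_smul, norm_neg, Complex.norm_I, one_mul]
        exact (norm_opHom_conjPoly Q2 φ).le
    set a := ‖testToL2 Ω (opHom Ω Q φ)‖
    set b := ‖testToL2 Ω (opHom Ω Q1 φ)‖
    have e4 : b ^ 2 ≤ a * (A * b + ‖testToL2 Ω (opHom Ω Q2 φ)‖) + b * (A * a) := by
      have h : (b : ℂ) ^ 2 = Complex.I * (inner ℂ (testToL2 Ω (opHom Ω (conjPoly Q) φ))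
          (testToL2 Ω (opHom Ω (conjPoly Q1) (coordOp Ω j φ))) -
          inner ℂ (testToL2 Ω (opHom Ω Q1 φ)) (testToL2 Ω (coordOp Ω j (opHom Ω Q φ)))) := by
        rw [← e2, ← inner_sub_right, ← inner_smul_right, ← map_sub, ← map_smul, ← e1]
        rw [inner_self_eq_norm_sq_to_K]; rfl
      have h' := congrArg norm h
      rw [norm_pow, Complex.norm_real, norm_norm, norm_mul, Complex.norm_I, one_mul] at h'
      rw [h']
      refine (norm_sub_le _ _).trans (add_le_add ?_ ?_)
      · refine (norm_inner_le_norm _ _).trans ?_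
        rw [norm_opHom_conjPoly]
        gcongr
      · refine (norm_inner_le_norm _ _).trans ?_
        gcongr
        exact norm_coordOp_le hA j _
    have hb : 0 ≤ b := norm_nonneg _
    have ha : 0 ≤ a := norm_nonneg _
    -- The induction hypothesis gives `b² ≤ a (A b + 2 d A b) + A a b`.
    have e5 : b * b ≤ b * (2 * (d + 1) * A * a) := by nlinarith
    rcases hb.eq_or_lt with h0 | h0
    · rw [← h0]; positivity
    · push_cast
      exact le_of_mul_le_mul_left e5 h0

theorem totalDegree_pderiv_le {R : Type*} [CommSemiring R] (j : Fin n)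
    (Q : MvPolynomial (Fin n) R) :
    (MvPolynomial.pderiv j Q).totalDegree ≤ Q.totalDegree - 1 := by
  refine Finset.sup_le fun β hβ => ?_
  rw [MvPolynomial.mem_support_iff, MvPolynomial.coeff_pderiv] at hβ
  have h := MvPolynomial.le_totalDegree (MvPolynomial.mem_support_iff.2 (left_ne_zero_of_mul hβ))
  change (β + Finsupp.single j 1).degree ≤ _ at h
  rw [map_add, Finsupp.degree_single] at h
  change β.degree ≤ _
  omega

theorem iterate_pderiv_eq_zero {R : Type*} [CommSemiring R] (j : Fin n)
    (Q : MvPolynomial (Fin n) R) : (MvPolynomial.pderiv j)^[Q.totalDegree + 1] Q = 0 := by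
  have : ∀ d (Q : MvPolynomial (Fin n) R), Q.totalDegree ≤ d →
      (MvPolynomial.pderiv j)^[d + 1] Q = 0 := by
    intro d
    induction d with
    | zero =>
      intro Q hQ
      rw [MvPolynomial.totalDegree_eq_zero_iff_eq_C.1 (Nat.le_zero.1 hQ)]
      simp
    | succ d ih =>
      intro Q hQ
      rw [Function.iterate_succ_apply]
      exact ih _ ((totalDegree_pderiv_le j Q).trans (by omega))
  exact this _ Q le_rfl

/-! ### Translated symbols and domination -/

/-- The substitution `Q(ξ) ↦ Q(ξ + t)`. -/
def shift (t : Fin n → ℂ) : MvPolynomial (Fin n) ℂ →ₐ[ℂ] MvPolynomial (Fin n) ℂ :=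
  MvPolynomial.aeval fun k => MvPolynomial.X k + MvPolynomial.C (t k)

theorem pderiv_shift (t : Fin n → ℂ) (j : Fin n) (Q : MvPolynomial (Fin n) ℂ) :
    MvPolynomial.pderiv j (shift t Q) = shift t (MvPolynomial.pderiv j Q) := by
  induction Q using MvPolynomial.induction_on with
  | C c => simp [shift]
  | add Q R hQ hR => simp only [map_add, hQ, hR]
  | mul_X Q k hQ =>
    have h1 : shift t (MvPolynomial.X k) = MvPolynomial.X k + MvPolynomial.C (t k) := by
      simp [shift]
    have h2 : shift t (Pi.single (M := fun _ => MvPolynomial (Fin n) ℂ) j 1 k) =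
        Pi.single (M := fun _ => MvPolynomial (Fin n) ℂ) j 1 k := by
      by_cases h : k = j
      · subst h; simp
      · simp [h]
    rw [map_mul, Derivation.leibniz, Derivation.leibniz, hQ, h1, map_add, MvPolynomial.pderiv_C,
      add_zero, MvPolynomial.pderiv_X, map_add]
    simp only [smul_eq_mul, map_mul, h1, h2]

theorem exists_norm_opHom_shift_pderiv_le (hΩ : Bornology.IsBounded (Ω : Set (Space n)))
    (j : Fin n) (Q : MvPolynomial (Fin n) ℂ) :
    ∃ C : ℝ, 0 ≤ C ∧ ∀ t (φ : 𝓓(Ω, ℂ)),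
      ‖testToL2 Ω (opHom Ω (shift t (MvPolynomial.pderiv j Q)) φ)‖ ≤
        C * ‖testToL2 Ω (opHom Ω (shift t Q) φ)‖ := by
  obtain ⟨A, hA0, hA⟩ := hΩ.exists_pos_norm_le
  refine ⟨2 * Q.totalDegree * A, by positivity, fun t φ => ?_⟩
  rw [← pderiv_shift]
  refine norm_opHom_pderiv_le_of_iterate hA hA0.le j _ _ ?_ φ
  have h : ∀ m R, (MvPolynomial.pderiv j)^[m] (shift t R) =
      shift t ((MvPolynomial.pderiv j)^[m] R) := fun m =>
    Function.Commute.iterate_left (pderiv_shift t j) m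
  rw [h, iterate_pderiv_eq_zero, map_zero]

/-- `Q(D)` dominates `R(D)` on `C₀^∞(Ω)`, uniformly under translations of the symbols. -/
def Dominates (Ω : Opens (Space n)) (Q R : MvPolynomial (Fin n) ℂ) : Prop :=
  ∃ C : ℝ, 0 ≤ C ∧ ∀ t (φ : 𝓓(Ω, ℂ)), ‖testToL2 Ω (opHom Ω (shift t R) φ)‖ ≤
    C * ‖testToL2 Ω (opHom Ω (shift t Q) φ)‖

theorem Dominates.refl (Q : MvPolynomial (Fin n) ℂ) : Dominates Ω Q Q :=
  ⟨1, zero_le_one, fun t φ => by rw [one_mul]⟩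

theorem Dominates.pderiv (hΩ : Bornology.IsBounded (Ω : Set (Space n)))
    {Q R : MvPolynomial (Fin n) ℂ} (h : Dominates Ω Q R) (j : Fin n) :
    Dominates Ω Q (MvPolynomial.pderiv j R) := by
  obtain ⟨C, hC, h⟩ := h
  obtain ⟨C', hC', h'⟩ := exists_norm_opHom_shift_pderiv_le hΩ j R
  refine ⟨C' * C, by positivity, fun t φ => (h' t φ).trans ?_⟩
  rw [mul_assoc]
  gcongr
  exact h t φ

theorem shift_zero (Q : MvPolynomial (Fin n) ℂ) : shift 0 Q = Q := by
  simp [shift]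

/-! ### Carleman estimate with linear exponential weights -/

/-- Exponential weights. -/
def weight (j : Fin n) (τ : ℝ) (x : Space n) : ℂ := Complex.exp (τ * (x j : ℝ))

theorem contDiff_weight (j : Fin n) (τ : ℝ) : ContDiff ℝ (⊤ : ℕ∞) (weight j τ : Space n → ℂ) :=
  Complex.contDiff_exp.comp (contDiff_const.mul (contDiff_coord j))

theorem fderiv_weight (j k : Fin n) (τ : ℝ) (x : Space n) :
    fderiv ℝ (weight j τ) x (EuclideanSpace.single k (1 : ℝ)) =
      if j = k then τ * weight j τ x else 0 := by
  have hd : DifferentiableAt ℝ (fun x : Space n => ((x j : ℝ) : ℂ)) x :=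
    ((contDiff_coord j).differentiable (by simp)) x
  have h : HasFDerivAt (weight j τ)
      (weight j τ x • ((τ : ℂ) • fderiv ℝ (fun x : Space n => ((x j : ℝ) : ℂ)) x)) x :=
    (hd.hasFDerivAt.const_mul (τ : ℂ)).cexp
  rw [h.fderiv, smul_apply, smul_apply, fderiv_coord]
  split_ifs <;> simp [mul_comm]

theorem dOp_weight (j k : Fin n) (τ : ℝ) (φ : 𝓓(Ω, ℂ)) :
    dOp Ω k (mulOp Ω (contDiff_weight j τ) φ) = mulOp Ω (contDiff_weight j τ) (dOp Ω k φ) -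
      (if j = k then Complex.I * τ else 0) • mulOp Ω (contDiff_weight j τ) φ := by
  rw [dOp_mulOp (contDiff_weight j τ)
    ((contDiff_const (c := if j = k then -Complex.I * τ else 0)).mul (contDiff_weight j τ))
    (fun x => by rw [fderiv_weight]; split_ifs <;> ring), sub_eq_add_neg, ← neg_smul]
  congr 1
  ext x
  rw [smul_testFunction_apply, mulOp_apply, mulOp_apply]
  split_ifs <;> ring

/-- Conjugation of `Q(D)` by an exponential weight translates the symbol. -/
theorem weight_opHom (j : Fin n) (τ : ℝ) (Q : MvPolynomial (Fin n) ℂ) (φ : 𝓓(Ω, ℂ)) :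
    mulOp Ω (contDiff_weight j τ) (opHom Ω Q φ) =
      opHom Ω (shift (Pi.single j (Complex.I * τ)) Q) (mulOp Ω (contDiff_weight j τ) φ) := by
  induction Q using MvPolynomial.induction_on generalizing φ with
  | C c => simp [shift]
  | add Q R hQ hR => simp only [map_add, LinearMap.add_apply, hQ, hR]
  | mul_X Q k hQ =>
    have h1 : shift (Pi.single j (Complex.I * τ)) (MvPolynomial.X k) =
        MvPolynomial.X k + MvPolynomial.C (if j = k then Complex.I * τ else 0) := by
      simp [shift, Pi.single_apply, eq_comm]
    rw [opHom_mul_apply, hQ, map_mul, opHom_mul_apply, h1, map_add, LinearMap.add_apply, opHom_X,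
     
      opHom_C, dOp_weight, sub_add_cancel]

/-- A nonconstant polynomial has an iterated derivative, or itself is, a nonconstant polynomial of
degree one. -/
theorem exists_dominated_degree_one (hΩ : Bornology.IsBounded (Ω : Set (Space n)))
    (P : MvPolynomial (Fin n) ℝ) (hP : 1 ≤ P.totalDegree) :
    ∃ R : MvPolynomial (Fin n) ℝ, R.totalDegree = 1 ∧
      Dominates Ω (toComplex P) (toComplex R) := by
  have : ∀ d (R : MvPolynomial (Fin n) ℝ), R.totalDegree ≤ d → 1 ≤ R.totalDegree →
      Dominates Ω (toComplex P) (toComplex R) →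
      ∃ R : MvPolynomial (Fin n) ℝ, R.totalDegree = 1 ∧
      Dominates Ω (toComplex P) (toComplex R) := by
    intro d
    induction d with
    | zero => intro R h1 h2; omega
    | succ d ih =>
      intro R h1 h2 hR
      rcases h2.eq_or_lt with h | h
      · exact ⟨R, h.symm, hR⟩
      -- Differentiating a monomial of degree at least 2 in a variable it contains leaves a
      -- nonconstant monomial, so the degree drops but stays positive.
      obtain ⟨α, hα, hd⟩ : ∃ α ∈ R.support, 2 ≤ α.degree := by
        by_contra! hcon
        have : R.totalDegree ≤ 1 :=
          Finset.sup_le fun α hα => Nat.le_of_lt_succ (hcon α hα)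
        omega
      obtain ⟨k, hk⟩ : ∃ k, α k ≠ 0 := by
        by_contra! h0
        have : α = 0 := Finsupp.ext h0
        simp [this] at hd
      have hle : Finsupp.single k 1 ≤ α := Finsupp.single_le_iff.2 (Nat.one_le_iff_ne_zero.2 hk)
      have hmem : α - Finsupp.single k 1 ∈ (MvPolynomial.pderiv k R).support := by
        rw [MvPolynomial.mem_support_iff, MvPolynomial.coeff_pderiv, tsub_add_cancel_of_le hle]
        exact mul_ne_zero (MvPolynomial.mem_support_iff.1 hα) (by positivity)
      refine ih (MvPolynomial.pderiv k R) ((totalDegree_pderiv_le k R).trans (by omega)) ?_ ?_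
      · have h3 := MvPolynomial.le_totalDegree hmem
        change (α - Finsupp.single k 1).degree ≤ _ at h3
        have h4 : (α - Finsupp.single k 1).degree + 1 = α.degree := by
          conv_rhs => rw [← tsub_add_cancel_of_le hle, map_add, Finsupp.degree_single]
        omega
      · have := hR.pderiv hΩ k
        rwa [MvPolynomial.pderiv_map] at this
  exact this _ P le_rfl hP (Dominates.refl _)

theorem exists_eq_single_of_degree_eq_one {α : Fin n →₀ ℕ} (h : α.degree = 1) :
    ∃ k, α = Finsupp.single k 1 := by
  obtain ⟨k, hk⟩ : ∃ k, α k ≠ 0 := by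
    by_contra! h0
    simp [show α = 0 from Finsupp.ext h0] at h
  have hle : Finsupp.single k 1 ≤ α := Finsupp.single_le_iff.2 (Nat.one_le_iff_ne_zero.2 hk)
  refine ⟨k, ?_⟩
  rw [← tsub_add_cancel_of_le hle, map_add, Finsupp.degree_single] at h
  have h0 : (α - Finsupp.single k 1).degree = 0 := by omega
  rw [← tsub_add_cancel_of_le hle, (Finsupp.degree_eq_zero_iff _).1 h0, zero_add]

/-- A top-degree monomial is some `c ξ_j`. Translation along `e_j` adds `τ c` and leaves all other
terms unchanged. -/
theorem exists_shift_of_degree_one {R : MvPolynomial (Fin n) ℝ} (hR : R.totalDegree = 1) :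
    ∃ (j : Fin n) (c : ℝ), c ≠ 0 ∧ ∀ τ : ℂ, shift (Pi.single j τ) (toComplex R) =
      toComplex R + MvPolynomial.C (τ * c) := by
  classical
  have hne : R.support.Nonempty := by
    rw [Finset.nonempty_iff_ne_empty]
    intro h
    rw [MvPolynomial.support_eq_empty.1 h] at hR
    simp at hR
  obtain ⟨α, hα, hαR⟩ := Finset.exists_mem_eq_sup R.support hne fun s => s.sum fun _ e => e
  have hα1 : α.degree = 1 := hαR.symm.trans hR
  obtain ⟨j, rfl⟩ := exists_eq_single_of_degree_eq_one hα1
  refine ⟨j, R.coeff (Finsupp.single j 1), MvPolynomial.mem_support_iff.1 hα, fun τ => ?_⟩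
  have hmono : ∀ β ∈ R.support, shift (Pi.single j τ)
      (MvPolynomial.monomial β ((R.coeff β : ℝ) : ℂ)) =
        MvPolynomial.monomial β ((R.coeff β : ℝ) : ℂ) +
          MvPolynomial.C (if Finsupp.single j 1 = β then τ * (R.coeff β : ℝ) else 0) := by
    intro β hβ
    have h1 : β.degree ≤ 1 := hR ▸ MvPolynomial.le_totalDegree hβ
    rcases Nat.le_one_iff_eq_zero_or_eq_one.1 h1 with h | h
    · rw [Finsupp.degree_eq_zero_iff] at h
      subst h
      simp [shift]
    · obtain ⟨k, rfl⟩ := exists_eq_single_of_degree_eq_one h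
      by_cases hjk : j = k
      · subst hjk
        simp [shift, MvPolynomial.monomial_eq, mul_add, mul_comm τ]
      · have hne : Finsupp.single j 1 ≠ (Finsupp.single k 1 : Fin n →₀ ℕ) := fun h =>
          hjk (Finsupp.single_left_injective one_ne_zero h)
        simp [shift, MvPolynomial.monomial_eq, hne, Pi.single_apply, Ne.symm hjk]
  have hR' : toComplex R = ∑ β ∈ R.support, MvPolynomial.monomial β ((R.coeff β : ℝ) : ℂ) := by
    conv_lhs => rw [R.as_sum, map_sum]
    exact Finset.sum_congr rfl fun β _ => MvPolynomial.map_monomial _ _ _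
  rw [hR', map_sum, Finset.sum_congr rfl hmono, Finset.sum_add_distrib, ← map_sum,
    Finset.sum_ite_eq, if_pos hα]

/-- Carleman estimate with linear weights. -/
theorem exists_weighted_estimate (hΩ : Bornology.IsBounded (Ω : Set (Space n)))
    (P : MvPolynomial (Fin n) ℝ) (hP : 1 ≤ P.totalDegree) :
    ∃ (j : Fin n) (c : ℝ), 0 < c ∧ ∀ (τ : ℝ) (φ : 𝓓(Ω, ℂ)),
      c * |τ| * ‖testToL2 Ω (mulOp Ω (contDiff_weight j τ) φ)‖ ≤
        ‖testToL2 Ω (mulOp Ω (contDiff_weight j τ) (polyOp P Ω φ))‖ := by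
  obtain ⟨R, hR, C, hC, hdom⟩ := exists_dominated_degree_one hΩ P hP
  obtain ⟨j, c, hc, hshift⟩ := exists_shift_of_degree_one hR
  have hc' : 0 < |c| := abs_pos.2 hc
  -- The `+ 1` keeps the denominator positive when `C = 0`.
  refine ⟨j, |c| / (C + 1), by positivity, fun τ φ => ?_⟩
  rw [polyOp_eq_opHom, weight_opHom]
  set ψ := mulOp Ω (contDiff_weight j τ) φ
  have h1 := hdom (Pi.single j (Complex.I * τ)) ψ
  rw [hshift, map_add, LinearMap.add_apply, opHom_C, map_add, map_smul] at h1
  set a := testToL2 Ω (opHom Ω (toComplex R) ψ) with ha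
  set f := testToL2 Ω ψ with hf
  set b := ‖testToL2 Ω (opHom Ω (shift (Pi.single j (Complex.I * τ)) (toComplex P)) ψ)‖
  have him : (inner ℂ a f : ℂ).im = 0 := by
    rw [← Complex.conj_eq_iff_im, inner_conj_symm, ha, hf, inner_opHom, MvPolynomial.map_map]
    rw [show (starRingEnd ℂ).comp Complex.ofRealHom = Complex.ofRealHom by ext x; simp]
  -- The operator `R(D)` is symmetric and the translation adds an imaginary constant, so the cross
  -- term has zero real part and Pythagoras applies.
  have h2 : ‖a + (Complex.I * τ * c) • f‖ ^ 2 = ‖a‖ ^ 2 + (|τ| * |c| * ‖f‖) ^ 2 := by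
    rw [norm_add_sq (𝕜 := ℂ), inner_smul_right, norm_smul]
    have : RCLike.re (Complex.I * τ * c * inner ℂ a f) = 0 := by
      simp [him]
    rw [this]
    simp
  have h3 : |τ| * |c| * ‖f‖ ≤ C * b := by
    refine le_trans ?_ h1
    refine le_of_sq_le_sq ?_ (norm_nonneg _)
    rw [h2]
    nlinarith [sq_nonneg ‖a‖]
  have hb : 0 ≤ b := norm_nonneg _
  rw [div_mul_eq_mul_div, div_mul_eq_mul_div, div_le_iff₀ (by positivity)]
  nlinarith

/-! ### Multiplication operators and unique continuation -/

/-- Multiplication by an essentially bounded function, acting on `L²(Ω)`. -/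
def mulL2 {g : Space n → ℂ} (hg : MemLp g ⊤ (volume.restrict (Ω : Set (Space n)))) :
    L2 Ω →L[ℂ] L2 Ω :=
  (ContinuousLinearMap.mul ℂ ℂ).holderL (volume.restrict (Ω : Set (Space n))) ⊤ 2 2 hg.toLp

theorem coeFn_mulL2 {g : Space n → ℂ} (hg : MemLp g ⊤ (volume.restrict (Ω : Set (Space n))))
    (f : L2 Ω) : mulL2 hg f =ᵐ[volume.restrict (Ω : Set (Space n))] fun x => g x * f x := by
  filter_upwards [(ContinuousLinearMap.mul ℂ ℂ).coeFn_holder (r := 2) (hg.toLp) f, hg.coeFn_toLp]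
    with x h1 h2
  rw [← h2]
  exact h1

theorem coeFn_testToL2 (φ : 𝓓(Ω, ℂ)) :
    testToL2 Ω φ =ᵐ[volume.restrict (Ω : Set (Space n))] φ :=
  MemLp.coeFn_toLp (memLp_testFunction φ)

theorem testToL2_mulOp {a : Space n → ℂ} (ha : ContDiff ℝ (⊤ : ℕ∞) a)
    (ha' : MemLp a ⊤ (volume.restrict (Ω : Set (Space n)))) (φ : 𝓓(Ω, ℂ)) :
    testToL2 Ω (mulOp Ω ha φ) = mulL2 ha' (testToL2 Ω φ) := by
  refine Lp.ext ?_
  filter_upwards [coeFn_testToL2 (mulOp Ω ha φ), coeFn_testToL2 φ,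
    coeFn_mulL2 ha' (testToL2 Ω φ)] with x h1 h2 h3
  rw [h1, h3, h2, mulOp_apply]

theorem mem_of_mem_minGraph {P : MvPolynomial (Fin n) ℝ} {S : Set (L2 Ω × L2 Ω)} (hS : IsClosed S)
    (h : ∀ φ, (testToL2 Ω φ, testToL2 Ω (polyOp P Ω φ)) ∈ S) {z : L2 Ω × L2 Ω}
    (hz : z ∈ minGraph P Ω) : z ∈ S :=
  closure_minimal (by rintro _ ⟨φ, rfl⟩; exact h φ) hS hz

theorem polyOp_sub_C (P : MvPolynomial (Fin n) ℝ) (l : ℝ) (φ : 𝓓(Ω, ℂ)) :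
    polyOp (P - MvPolynomial.C l) Ω φ = polyOp P Ω φ - (l : ℂ) • φ := by
  rw [polyOp_eq_opHom, polyOp_eq_opHom, map_sub, map_sub, LinearMap.sub_apply,
    MvPolynomial.map_C, opHom_C]
  rfl

theorem one_le_totalDegree_sub_C {P : MvPolynomial (Fin n) ℝ} (hP : 1 ≤ P.totalDegree) (l : ℝ) :
    1 ≤ (P - MvPolynomial.C l).totalDegree := by
  by_contra! h
  have h1 := MvPolynomial.totalDegree_eq_zero_iff_eq_C.1 (Nat.lt_one_iff.1 h)
  rw [sub_eq_iff_eq_add, ← map_add] at h1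
  rw [h1, MvPolynomial.totalDegree_C] at hP
  omega

theorem memLp_top_weight (hΩ : Bornology.IsBounded (Ω : Set (Space n))) (j : Fin n) (τ : ℝ) :
    MemLp (weight j τ) ⊤ (volume.restrict (Ω : Set (Space n))) := by
  obtain ⟨A, -, hA⟩ := hΩ.exists_pos_norm_le
  refine memLp_top_of_bound (contDiff_weight j τ).continuous.aestronglyMeasurable
    (Real.exp (|τ| * A)) ?_
  filter_upwards [ae_restrict_mem Ω.isOpen.measurableSet] with x hx
  rw [weight, Complex.norm_exp, ← Complex.ofReal_mul, Complex.ofReal_re, Real.exp_le_exp]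
  calc τ * x j ≤ |τ * x j| := le_abs_self _
    _ = |τ| * ‖x j‖ := abs_mul _ _
    _ ≤ |τ| * A := by gcongr; exact (PiLp.norm_apply_le x j).trans (hA x hx)

/-- Unique continuation: a solution of `|(P(D) - l) u| ≤ M |u|` in `H₀^P(Ω)` vanishes. -/
theorem eq_zero_of_mem_minGraph_of_norm_le (hΩ : Bornology.IsBounded (Ω : Set (Space n)))
    {P : MvPolynomial (Fin n) ℝ} (hP : 1 ≤ P.totalDegree) {z : L2 Ω × L2 Ω}
    (hz : z ∈ minGraph P Ω) (l M : ℝ)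
    (hM : ∀ᵐ x ∂(volume.restrict (Ω : Set (Space n))), ‖(z.2 - (l : ℂ) • z.1) x‖ ≤ M * ‖z.1 x‖) :
    z.1 = 0 := by
  obtain ⟨j, c, hc, hest⟩ := exists_weighted_estimate hΩ _ (one_le_totalDegree_sub_C hP l)
  -- Chosen so that `c * |τ| = |M| + 1` exceeds `M`: the Carleman bound then contradicts the
  -- pointwise one unless the weighted function vanishes.
  set τ : ℝ := (|M| + 1) / c
  have hτ : c * |τ| = |M| + 1 := by
    rw [abs_of_pos (by positivity)]
    exact mul_div_cancel₀ _ hc.ne'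
  have hw := memLp_top_weight hΩ j τ
  have h1 : c * |τ| * ‖mulL2 hw z.1‖ ≤ ‖mulL2 hw (z.2 - (l : ℂ) • z.1)‖ := by
    refine mem_of_mem_minGraph (S := {z : L2 Ω × L2 Ω |
      c * |τ| * ‖mulL2 hw z.1‖ ≤ ‖mulL2 hw (z.2 - (l : ℂ) • z.1)‖})
      (isClosed_le (by fun_prop) (by fun_prop)) (fun φ => ?_) hz
    have h := hest τ φ
    rwa [polyOp_sub_C, testToL2_mulOp _ hw, testToL2_mulOp _ hw, map_sub, map_smul] at h
  have h2 : ‖mulL2 hw (z.2 - (l : ℂ) • z.1)‖ ≤ M * ‖mulL2 hw z.1‖ := by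
    refine Lp.norm_le_mul_norm_of_ae_le_mul ?_
    filter_upwards [coeFn_mulL2 hw z.1, coeFn_mulL2 hw (z.2 - (l : ℂ) • z.1), hM] with x e1 e2 e3
    rw [e1, e2, norm_mul, norm_mul, mul_left_comm]
    gcongr
  rw [hτ] at h1
  have h3 : mulL2 hw z.1 = 0 := by
    rw [← norm_le_zero_iff]
    nlinarith [le_abs_self M, norm_nonneg (mulL2 hw z.1)]
  refine Lp.eq_zero_iff_ae_eq_zero.2 ?_
  filter_upwards [coeFn_mulL2 hw z.1, Lp.eq_zero_iff_ae_eq_zero.1 h3] with x e1 e2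
  rw [e1] at e2
  exact (mul_eq_zero.1 e2).resolve_left (Complex.exp_ne_zero _)

/-! ### Fourier transform and compactness of the embedding -/

open scoped FourierTransform SchwartzMap LineDeriv

/-- A test function, regarded as a Schwartz function. -/
def toSchwartz (φ : 𝓓(Ω, ℂ)) : 𝓢(Space n, ℂ) := φ.hasCompactSupport.toSchwartzMap φ.contDiff

/-- The Fourier transform of a test function. -/
def hat (φ : 𝓓(Ω, ℂ)) : 𝓢(Space n, ℂ) := 𝓕 (toSchwartz φ)

theorem hat_add (φ ψ : 𝓓(Ω, ℂ)) : hat (φ + ψ) = hat φ + hat ψ := by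
  rw [hat, hat, hat, ← FourierTransform.fourier_add]
  rfl

theorem hat_smul (c : ℂ) (φ : 𝓓(Ω, ℂ)) : hat (c • φ) = c • hat φ := by
  rw [hat, hat, ← FourierTransform.fourier_smul]
  rfl

theorem hat_dOp (k : Fin n) (φ : 𝓓(Ω, ℂ)) (ξ : Space n) :
    hat (dOp Ω k φ) ξ = ((2 * Real.pi * ξ k : ℝ) : ℂ) * hat φ ξ := by
  have h : toSchwartz (dOp Ω k φ) =
      (-Complex.I) • ∂_{(EuclideanSpace.single k (1 : ℝ) : Space n)} (toSchwartz φ) := by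
    ext x
    change dOp Ω k φ x = -Complex.I * fderiv ℝ φ x (EuclideanSpace.single k (1 : ℝ))
    rw [dOp_apply]
  have ht : (fun x : Space n =>
      (inner ℝ x (EuclideanSpace.single k (1 : ℝ) : Space n) : ℝ)).HasTemperateGrowth :=
    ((innerSL ℝ).flip (EuclideanSpace.single k (1 : ℝ) : Space n)).hasTemperateGrowth
  rw [hat, h, FourierTransform.fourier_smul, SchwartzMap.fourier_lineDerivOp_eq, smul_apply,
    smul_apply, SchwartzMap.smulLeftCLM_apply_apply ht]
  simp only [EuclideanSpace.inner_single_right, smul_eq_mul, Complex.real_smul, hat, conj_trivial]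
  push_cast
  linear_combination (-(2 * Real.pi * ξ k * 𝓕 (toSchwartz φ) ξ)) * Complex.I_mul_I

theorem hat_opHom (Q : MvPolynomial (Fin n) ℂ) (φ : 𝓓(Ω, ℂ)) (ξ : Space n) :
    hat (opHom Ω Q φ) ξ =
      MvPolynomial.eval (fun k => ((2 * Real.pi * ξ k : ℝ) : ℂ)) Q * hat φ ξ := by
  induction Q using MvPolynomial.induction_on generalizing φ with
  | C c => rw [opHom_C, hat_smul, MvPolynomial.eval_C]; rfl
  | add Q R hQ hR =>
    rw [map_add, LinearMap.add_apply, hat_add, add_apply, hQ, hR, map_add, add_mul]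
  | mul_X Q k hQ =>
    rw [opHom_mul_apply, hQ, opHom_X, hat_dOp, map_mul, MvPolynomial.eval_X, ← mul_assoc]

theorem hat_opHom_toComplex (Q : MvPolynomial (Fin n) ℝ) (φ : 𝓓(Ω, ℂ)) (ξ : Space n) :
    hat (opHom Ω (toComplex Q) φ) ξ = ((symbol Q ((2 * Real.pi) • ξ) : ℝ) : ℂ) * hat φ ξ := by
  rw [hat_opHom]
  congr 1
  rw [MvPolynomial.eval_map]
  exact (MvPolynomial.eval₂_comp_left Complex.ofRealHom (RingHom.id ℝ)
    (fun k => 2 * Real.pi * ξ k) Q).symm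

theorem inner_testToL2_eq_integral_hat (φ ψ : 𝓓(Ω, ℂ)) :
    inner ℂ (testToL2 Ω φ) (testToL2 Ω ψ) = ∫ ξ, starRingEnd ℂ (hat φ ξ) * hat ψ ξ := by
  rw [inner_testToL2_testToL2]
  have h := SchwartzMap.integral_inner_fourier_fourier (toSchwartz φ) (toSchwartz ψ)
  simp only [RCLike.inner_apply'] at h
  exact h.symm

theorem norm_sq_testToL2 (φ : 𝓓(Ω, ℂ)) :
    ‖testToL2 Ω φ‖ ^ 2 = ∫ ξ, ‖hat φ ξ‖ ^ 2 := by
  have h := inner_testToL2_eq_integral_hat φ φ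
  rw [inner_self_eq_norm_sq_to_K] at h
  simp only [Complex.conj_mul'] at h
  norm_cast at h
  exact Complex.ofReal_injective h

theorem integrable_norm_sq_hat (φ : 𝓓(Ω, ℂ)) : Integrable fun ξ => ‖hat φ ξ‖ ^ 2 :=
  ((hat φ).memLp 2).integrable_norm_pow (by norm_num)

/-- By Parseval the form of `P(D) - c` is the integral of the nonnegative function `P(2πξ) - c`
against `|φ̂|²`. The factor `2π` comes from the normalisation of the Fourier transform. -/
theorem re_inner_polyOp_ge {P : MvPolynomial (Fin n) ℝ} {c : ℝ} (hc : ∀ ξ, c ≤ symbol P ξ)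
    (φ : 𝓓(Ω, ℂ)) :
    c * ‖testToL2 Ω φ‖ ^ 2 ≤ (inner ℂ (testToL2 Ω φ) (testToL2 Ω (polyOp P Ω φ))).re := by
  have h := inner_testToL2_eq_integral_hat φ (polyOp (P - MvPolynomial.C c) Ω φ)
  rw [polyOp_eq_opHom] at h
  have h1 : ∀ ξ, starRingEnd ℂ (hat φ ξ) * hat (opHom Ω (toComplex (P - MvPolynomial.C c)) φ) ξ =
      (((symbol P ((2 * Real.pi) • ξ) - c) * ‖hat φ ξ‖ ^ 2 : ℝ) : ℂ) := by
    intro ξ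
    rw [hat_opHom_toComplex, mul_left_comm, Complex.conj_mul']
    simp [symbol]
  simp only [h1] at h
  rw [integral_complex_ofReal, ← polyOp_eq_opHom, polyOp_sub_C, map_sub, map_smul, inner_sub_right,
    inner_smul_right, inner_self_eq_norm_sq_to_K] at h
  have h2 : 0 ≤ ∫ ξ, (symbol P ((2 * Real.pi) • ξ) - c) * ‖hat φ ξ‖ ^ 2 :=
    integral_nonneg fun ξ => mul_nonneg (sub_nonneg.2 (hc _)) (sq_nonneg _)
  have h3 := congrArg Complex.re h
  rw [Complex.sub_re, Complex.ofReal_re] at h3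
  have h4 : ((c : ℂ) * ((‖testToL2 Ω φ‖ : ℝ) : ℂ) ^ 2).re = c * ‖testToL2 Ω φ‖ ^ 2 := by
    norm_cast
  rw [show (RCLike.ofReal ‖testToL2 Ω φ‖ : ℂ) = ((‖testToL2 Ω φ‖ : ℝ) : ℂ) from rfl, h4] at h3
  linarith

theorem Dominates.polyDeriv (hΩ : Bornology.IsBounded (Ω : Set (Space n)))
    (P : MvPolynomial (Fin n) ℝ) (α : Fin n → ℕ) :
    Dominates Ω (toComplex P) (toComplex (polyDeriv α P)) := by
  let good (A : Module.End ℝ (MvPolynomial (Fin n) ℝ)) : Prop :=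
    ∀ R, Dominates Ω (toComplex P) (toComplex R) → Dominates Ω (toComplex P) (toComplex (A R))
  have hlist : ∀ l : List (Module.End ℝ (MvPolynomial (Fin n) ℝ)), (∀ A ∈ l, good A) →
      good l.prod := by
    intro l
    induction l with
    | nil => intro _ R hR; simpa using hR
    | cons A l ih =>
      intro h R hR
      rw [List.prod_cons, Module.End.mul_apply]
      exact h A (by simp) _ (ih (fun B hB => h B (by simp [hB])) R hR)
  refine hlist _ (fun A hA => ?_) P (Dominates.refl _)
  obtain ⟨j, rfl⟩ := (List.mem_ofFn' _ _).1 hA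
  change good (_ ^ α j)
  rw [← List.prod_replicate]
  refine hlist _ fun A hA R hR => ?_
  rw [List.eq_of_mem_replicate hA]
  have := hR.pderiv hΩ j
  rwa [MvPolynomial.pderiv_map] at this

/-- `∫ P̃(2πξ)² |φ̂(ξ)|² dξ ≤ C ‖P(D) φ‖²`. -/
theorem exists_integral_symbolTilde_le (hΩ : Bornology.IsBounded (Ω : Set (Space n)))
    (P : MvPolynomial (Fin n) ℝ) :
    ∃ C : ℝ, 0 < C ∧ ∀ φ : 𝓓(Ω, ℂ),
      Integrable (fun ξ => symbolTilde P ((2 * Real.pi) • ξ) ^ 2 * ‖hat φ ξ‖ ^ 2) ∧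
      ∫ ξ, symbolTilde P ((2 * Real.pi) • ξ) ^ 2 * ‖hat φ ξ‖ ^ 2 ≤
        C * ‖testToL2 Ω (polyOp P Ω φ)‖ ^ 2 := by
  choose C hC hCle using fun α : Fin n → Fin (P.totalDegree + 1) =>
    Dominates.polyDeriv hΩ P (fun j => (α j : ℕ))
  refine ⟨∑ α, C α ^ 2 + 1, by positivity, fun φ => ?_⟩
  have h1 : (fun ξ => symbolTilde P ((2 * Real.pi) • ξ) ^ 2 * ‖hat φ ξ‖ ^ 2) = fun ξ =>
      ∑ α : Fin n → Fin (P.totalDegree + 1),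
        ‖hat (opHom Ω (toComplex (polyDeriv (fun j => (α j : ℕ)) P)) φ) ξ‖ ^ 2 := by
    ext ξ
    rw [symbolTilde, Real.sq_sqrt (by positivity), Finset.sum_mul]
    refine Finset.sum_congr rfl fun α _ => ?_
    rw [hat_opHom_toComplex, norm_mul, Complex.norm_real, Real.norm_eq_abs, mul_pow]
  rw [h1]
  refine ⟨integrable_finsetSum _ fun α _ => integrable_norm_sq_hat _, ?_⟩
  rw [integral_finsetSum _ fun α _ => integrable_norm_sq_hat _, add_mul, Finset.sum_mul]
  refine le_add_of_le_of_nonneg (Finset.sum_le_sum fun α _ => ?_) (by positivity)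
  rw [← norm_sq_testToL2, ← mul_pow]
  have := hCle α 0 φ
  rw [shift_zero, shift_zero] at this
  rw [polyOp_eq_opHom]
  gcongr

/-- The exponential `x ↦ exp(2πi ⟨x, ξ⟩)`. -/
def expFun (ξ x : Space n) : ℂ := Complex.exp ((2 * Real.pi * inner ℝ x ξ : ℝ) * Complex.I)

theorem norm_expFun (ξ x : Space n) : ‖expFun ξ x‖ = 1 := Complex.norm_exp_ofReal_mul_I _

theorem continuous_expFun (ξ : Space n) : Continuous (expFun ξ) := by
  unfold expFun; fun_prop

theorem isFiniteMeasure_restrict_of_isBounded (hΩ : Bornology.IsBounded (Ω : Set (Space n))) :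
    IsFiniteMeasure ((volume : Measure (Space n)).restrict (Ω : Set (Space n))) :=
  ⟨by simpa using hΩ.measure_lt_top⟩

theorem memLp_expFun (hΩ : Bornology.IsBounded (Ω : Set (Space n))) (ξ : Space n) :
    MemLp (expFun ξ) 2 (volume.restrict (Ω : Set (Space n))) :=
  have := isFiniteMeasure_restrict_of_isBounded hΩ
  MemLp.of_bound (continuous_expFun ξ).aestronglyMeasurable 1
    (Eventually.of_forall fun x => (norm_expFun ξ x).le)

theorem hat_eq_inner (hΩ : Bornology.IsBounded (Ω : Set (Space n))) (φ : 𝓓(Ω, ℂ)) (ξ : Space n) :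
    hat φ ξ = inner ℂ (memLp_expFun hΩ ξ).toLp (testToL2 Ω φ) := by
  rw [MeasureTheory.L2.inner_def]
  have h1 : hat φ ξ = ∫ x, starRingEnd ℂ (expFun ξ x) * φ x := by
    rw [hat, SchwartzMap.fourier_coe, Real.fourier_eq']
    refine integral_congr_ae (Eventually.of_forall fun x => ?_)
    change Complex.exp _ * φ x = _
    dsimp only [expFun]
    rw [← Complex.exp_conj, map_mul, Complex.conj_ofReal, Complex.conj_I]
    congr 2
    push_cast
    ring
  rw [h1, ← setIntegral_eq_integral_of_forall_compl_eq_zero (s := (Ω : Set (Space n)))]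
  · refine integral_congr_ae ?_
    filter_upwards [(memLp_expFun hΩ ξ).coeFn_toLp, coeFn_testToL2 φ] with x e1 e2
    rw [e1, e2, RCLike.inner_apply']
  · intro x hx
    rw [image_eq_zero_of_notMem_tsupport fun h => hx (φ.tsupport_subset h), mul_zero]

theorem norm_expFun_sub_le {A : ℝ} {ξ η x : Space n} (hx : ‖x‖ ≤ A) :
    ‖expFun ξ x - expFun η x‖ ≤ 2 * Real.pi * A * ‖ξ - η‖ := by
  have h1 : expFun ξ x - expFun η x = expFun η x *
      (Complex.exp (Complex.I * (2 * Real.pi * inner ℝ x (ξ - η) : ℝ)) - 1) := by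
    dsimp only [expFun]
    rw [mul_sub, ← Complex.exp_add, mul_one, inner_sub_right]
    congr 2
    push_cast
    ring
  rw [h1, norm_mul, norm_expFun, one_mul]
  refine Real.norm_exp_I_mul_ofReal_sub_one_le.trans ?_
  rw [norm_mul, Real.norm_of_nonneg (by positivity), mul_assoc (2 * Real.pi)]
  gcongr
  exact (norm_inner_le_norm _ _).trans (by gcongr)

/-- On a bounded set the characters are Lipschitz in the frequency, uniformly in `x`. Values of `φ̂`
on a finite net therefore control it on a ball. -/
theorem exists_norm_hat_sub_le (hΩ : Bornology.IsBounded (Ω : Set (Space n))) :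
    ∃ L : ℝ, 0 < L ∧ ∀ (φ : 𝓓(Ω, ℂ)) (ξ η : Space n),
      ‖hat φ ξ - hat φ η‖ ≤ L * ‖ξ - η‖ * ‖testToL2 Ω φ‖ := by
  obtain ⟨A, hA0, hA⟩ := hΩ.exists_pos_norm_le
  have := isFiniteMeasure_restrict_of_isBounded hΩ
  set μ := (volume : Measure (Space n)).restrict (Ω : Set (Space n))
  set m : ℝ := measureUnivNNReal μ ^ (ENNReal.toReal 2)⁻¹
  refine ⟨m * (2 * Real.pi * A) + 1, by positivity, fun φ ξ η => ?_⟩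
  rw [hat_eq_inner hΩ, hat_eq_inner hΩ, ← inner_sub_left, ← MemLp.toLp_sub]
  refine (norm_inner_le_norm _ _).trans ?_
  gcongr
  refine (Lp.norm_le_of_ae_bound (C := 2 * Real.pi * A * ‖ξ - η‖) (by positivity) ?_).trans ?_
  · filter_upwards [MemLp.coeFn_toLp ((memLp_expFun hΩ ξ).sub (memLp_expFun hΩ η)),
      ae_restrict_mem Ω.isOpen.measurableSet] with x e1 hx
    rw [e1]
    exact norm_expFun_sub_le (hA x hx)
  · nlinarith [norm_nonneg (ξ - η)]

/-- Compactness of `H₀^P(Ω) → L²(Ω)`, in quantitative form. -/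
theorem exists_finite_rank_estimate (hΩ : Bornology.IsBounded (Ω : Set (Space n)))
    {P : MvPolynomial (Fin n) ℝ}
    (hP : Tendsto (symbolTilde P) (cocompact (Space n)) atTop) {ε : ℝ} (hε : 0 < ε) :
    ∃ (k : ℕ) (T : L2 Ω →L[ℂ] EuclideanSpace ℂ (Fin k)), ∀ φ : 𝓓(Ω, ℂ),
      ‖testToL2 Ω φ‖ ^ 2 ≤ ε * ‖testToL2 Ω (polyOp P Ω φ)‖ ^ 2 + ε * ‖testToL2 Ω φ‖ ^ 2 +
        ‖T (testToL2 Ω φ)‖ ^ 2 := by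
  obtain ⟨C, hC, hCle⟩ := exists_integral_symbolTilde_le hΩ P
  obtain ⟨L, hL, hLip⟩ := exists_norm_hat_sub_le hΩ
  -- High frequencies: beyond `R` the weight `P̃²` is at least `C / ε`, so they are absorbed by
  -- `‖P(D) φ‖²`.
  obtain ⟨R, hR⟩ : ∃ R : ℝ, ∀ ξ : Space n, R < ‖ξ‖ →
      1 ≤ ε / C * symbolTilde P ((2 * Real.pi) • ξ) ^ 2 := by
    have h1 := hP.eventually (eventually_ge_atTop (Real.sqrt (C / ε)))
    rw [← Metric.cobounded_eq_cocompact, ← comap_norm_atTop] at h1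
    obtain ⟨R, hR⟩ := (Filter.eventually_comap.1 h1).exists_forall_of_atTop
    refine ⟨R, fun ξ hξ => ?_⟩
    have h2 : Real.sqrt (C / ε) ≤ symbolTilde P ((2 * Real.pi) • ξ) := by
      refine hR _ ?_ _ rfl
      rw [norm_smul, Real.norm_of_nonneg (by positivity)]
      nlinarith [Real.pi_gt_three, norm_nonneg ξ]
    have h3 : C / ε ≤ symbolTilde P ((2 * Real.pi) • ξ) ^ 2 :=
      (Real.sqrt_le_left (Real.sqrt_nonneg _ |>.trans h2)).1 h2
    calc 1 = ε / C * (C / ε) := by field_simp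
      _ ≤ _ := by gcongr
  set B : Set (Space n) := Metric.closedBall 0 R
  set v : ℝ := (volume : Measure (Space n)).real B
  have hv : 0 ≤ v := measureReal_nonneg
  -- Low frequencies: the mesh `h` is small enough that the Lipschitz error, integrated over the
  -- ball, costs at most `ε ‖φ‖²`.
  obtain ⟨h, hh, hhv⟩ : ∃ h : ℝ, 0 < h ∧ v * (2 * (L * h) ^ 2) ≤ ε := by
    refine ⟨Real.sqrt (ε / (2 * L ^ 2 * (v + 1))), by positivity, ?_⟩
    rw [mul_pow, Real.sq_sqrt (by positivity)]
    have : v * (2 * (L ^ 2 * (ε / (2 * L ^ 2 * (v + 1))))) = ε * (v / (v + 1)) := by field_simp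
    rw [this]
    exact mul_le_of_le_one_right hε.le ((div_le_one (by positivity)).2 (by linarith))
  obtain ⟨t, htB, htf, htc⟩ := (isCompact_closedBall (0 : Space n) R).finite_cover_balls hh
  obtain ⟨k, p, hp⟩ : ∃ (k : ℕ) (p : Fin k → Space n), range p = t := by
    have := htf.to_subtype
    obtain ⟨k, ⟨e⟩⟩ := Finite.exists_equiv_fin t
    exact ⟨k, fun i => e.symm i, by
      rw [← Function.comp_def, range_comp, e.symm.range_eq_univ, image_univ, Subtype.range_coe]⟩
  -- Samples of `φ̂` at the net points; the factor `√(2 v)` accounts for the volume of the ball and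
  -- the 2 in `(x + y)² ≤ 2x² + 2y²`.
  let T : L2 Ω →L[ℂ] EuclideanSpace ℂ (Fin k) :=
    (EuclideanSpace.equiv (Fin k) ℂ).symm.toContinuousLinearMap.comp
      (ContinuousLinearMap.pi fun i => ((Real.sqrt (2 * v) : ℝ) : ℂ) •
        innerSL ℂ (memLp_expFun hΩ (p i)).toLp)
  have hT : ∀ φ, ‖T (testToL2 Ω φ)‖ ^ 2 = v * ∑ i, 2 * ‖hat φ (p i)‖ ^ 2 := by
    intro φ
    rw [EuclideanSpace.norm_sq_eq, Finset.mul_sum]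
    refine Finset.sum_congr rfl fun i _ => ?_
    change ‖((Real.sqrt (2 * v) : ℝ) : ℂ) • inner ℂ _ (testToL2 Ω φ)‖ ^ 2 = _
    rw [hat_eq_inner hΩ, norm_smul, mul_pow, Complex.norm_real, Real.norm_eq_abs, sq_abs,
      Real.sq_sqrt (by positivity)]
    ring
  refine ⟨k, T, fun φ => ?_⟩
  obtain ⟨hint, hCφ⟩ := hCle φ
  set K : ℝ := 2 * (L * h * ‖testToL2 Ω φ‖) ^ 2 + ∑ i, 2 * ‖hat φ (p i)‖ ^ 2
  have hK : 0 ≤ K := by positivity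
  have hpt : ∀ ξ, ‖hat φ ξ‖ ^ 2 ≤
      ε / C * (symbolTilde P ((2 * Real.pi) • ξ) ^ 2 * ‖hat φ ξ‖ ^ 2) +
        B.indicator (fun _ => K) ξ := by
    intro ξ
    by_cases hξ : ξ ∈ B
    · rw [indicator_of_mem hξ]
      refine le_add_of_nonneg_of_le (by positivity) ?_
      obtain ⟨y, hy, hξy⟩ := mem_iUnion₂.1 (htc hξ)
      obtain ⟨i, rfl⟩ : y ∈ range p := hp ▸ hy
      have h1 := hLip φ ξ (p i)
      have h2 : ‖hat φ ξ - hat φ (p i)‖ ≤ L * h * ‖testToL2 Ω φ‖ := by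
        refine h1.trans ?_
        gcongr
        exact (mem_ball_iff_norm.1 hξy).le
      have h3 : ‖hat φ ξ‖ ≤ ‖hat φ ξ - hat φ (p i)‖ + ‖hat φ (p i)‖ := by
        simpa using norm_add_le (hat φ ξ - hat φ (p i)) (hat φ (p i))
      have h4 : 2 * ‖hat φ (p i)‖ ^ 2 ≤ ∑ i, 2 * ‖hat φ (p i)‖ ^ 2 :=
        Finset.single_le_sum (f := fun i => 2 * ‖hat φ (p i)‖ ^ 2) (fun _ _ => by positivity)
          (Finset.mem_univ i)
      calc ‖hat φ ξ‖ ^ 2 ≤ (L * h * ‖testToL2 Ω φ‖ + ‖hat φ (p i)‖) ^ 2 := by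
            gcongr; linarith
        _ ≤ 2 * (L * h * ‖testToL2 Ω φ‖) ^ 2 + 2 * ‖hat φ (p i)‖ ^ 2 := by
            nlinarith [sq_nonneg (L * h * ‖testToL2 Ω φ‖ - ‖hat φ (p i)‖)]
        _ ≤ K := add_le_add_right h4 _
    · rw [indicator_of_notMem hξ, add_zero, ← mul_assoc]
      refine le_mul_of_one_le_left (by positivity) (hR ξ ?_)
      simpa [B] using hξ
  have hBint : Integrable (B.indicator fun _ : Space n => K) :=
    (integrable_indicator_iff measurableSet_closedBall).2
      (integrableOn_const (measure_closedBall_lt_top).ne)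
  have hfin := integral_mono (integrable_norm_sq_hat φ) ((hint.const_mul (ε / C)).add hBint) hpt
  rw [← norm_sq_testToL2, integral_add' (hint.const_mul (ε / C)) hBint, integral_const_mul,
    integral_indicator measurableSet_closedBall, setIntegral_const, smul_eq_mul] at hfin
  rw [hT]
  have h5 : ε / C * ∫ ξ, symbolTilde P ((2 * Real.pi) • ξ) ^ 2 * ‖hat φ ξ‖ ^ 2 ≤
      ε * ‖testToL2 Ω (polyOp P Ω φ)‖ ^ 2 := by
    calc _ ≤ ε / C * (C * ‖testToL2 Ω (polyOp P Ω φ)‖ ^ 2) := by gcongr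
      _ = _ := by field_simp
  have h6 : v * K = v * (2 * (L * h) ^ 2) * ‖testToL2 Ω φ‖ ^ 2 +
      v * ∑ i, 2 * ‖hat φ (p i)‖ ^ 2 := by
    simp only [K]; ring
  have h7 := mul_le_mul_of_nonneg_right hhv (sq_nonneg ‖testToL2 Ω φ‖)
  change _ ≤ _ + v * K at hfin
  linarith

/-! ### The graph Hilbert space and the quadratic form -/

variable {P : MvPolynomial (Fin n) ℝ}

theorem inner_symm_of_mem_minGraph {z w : L2 Ω × L2 Ω} (hz : z ∈ minGraph P Ω)
    (hw : w ∈ minGraph P Ω) : inner ℂ z.2 w.1 = inner ℂ z.1 w.2 := by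
  have hcc : conjPoly (toComplex P) = toComplex P := by
    rw [MvPolynomial.map_map]
    rw [show (starRingEnd ℂ).comp Complex.ofRealHom = Complex.ofRealHom by ext x; simp]
  refine mem_of_mem_minGraph (S := {z : L2 Ω × L2 Ω | inner ℂ z.2 w.1 = inner ℂ z.1 w.2})
    (isClosed_eq (by fun_prop) (by fun_prop)) (fun φ => ?_) hz
  refine mem_of_mem_minGraph (S := {w : L2 Ω × L2 Ω | inner ℂ (testToL2 Ω (polyOp P Ω φ)) w.1 =
    inner ℂ (testToL2 Ω φ) w.2}) (isClosed_eq (by fun_prop) (by fun_prop)) (fun ψ => ?_) hw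
  change inner ℂ (testToL2 Ω (polyOp P Ω φ)) (testToL2 Ω ψ) =
    inner ℂ (testToL2 Ω φ) (testToL2 Ω (polyOp P Ω ψ))
  rw [polyOp_eq_opHom, inner_opHom, hcc]

theorem re_inner_ge_of_mem_minGraph {c : ℝ} (hc : ∀ ξ, c ≤ symbol P ξ) {z : L2 Ω × L2 Ω}
    (hz : z ∈ minGraph P Ω) : c * ‖z.1‖ ^ 2 ≤ (inner ℂ z.1 z.2).re :=
  mem_of_mem_minGraph (S := {z : L2 Ω × L2 Ω | c * ‖z.1‖ ^ 2 ≤ (inner ℂ z.1 z.2 : ℂ).re})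
    (isClosed_le (by fun_prop) (Complex.continuous_re.comp (by fun_prop)))
    (fun φ => re_inner_polyOp_ge hc φ) hz

theorem symbol_neg (ξ : Space n) : symbol (-P) ξ = -symbol P ξ := by simp [symbol]

theorem re_inner_le_of_mem_minGraph {c : ℝ} (hc : ∀ ξ, c ≤ -symbol P ξ) {z : L2 Ω × L2 Ω}
    (hz : z ∈ minGraph P Ω) : (inner ℂ z.1 z.2).re ≤ -(c * ‖z.1‖ ^ 2) := by
  refine mem_of_mem_minGraph (S := {z : L2 Ω × L2 Ω | (inner ℂ z.1 z.2 : ℂ).re ≤ -(c * ‖z.1‖ ^ 2)})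
    (isClosed_le (Complex.continuous_re.comp (by fun_prop)) (by fun_prop)) (fun φ => ?_) hz
  have h := re_inner_polyOp_ge (P := -P) (fun ξ => (hc ξ).trans_eq (symbol_neg ξ).symm) φ
  rw [polyOp_eq_opHom, map_neg, map_neg, LinearMap.neg_apply, map_neg, inner_neg_right,
    Complex.neg_re, ← polyOp_eq_opHom] at h
  change (inner ℂ (testToL2 Ω φ) (testToL2 Ω (polyOp P Ω φ)) : ℂ).re ≤ _
  linarith

/-- The graph of `minOp P Ω` with its Hilbert space structure. -/
def graphSpace (P : MvPolynomial (Fin n) ℝ) (Ω : Opens (Space n)) :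
    Submodule ℂ (WithLp 2 (L2 Ω × L2 Ω)) :=
  (minGraph P Ω).comap (WithLp.linearEquiv 2 ℂ (L2 Ω × L2 Ω)).toLinearMap

instance : CompleteSpace (graphSpace P Ω) := by
  have hc : IsClosed (minGraph P Ω : Set (L2 Ω × L2 Ω)) := Submodule.isClosed_topologicalClosure _
  have h : IsClosed (graphSpace P Ω : Set (WithLp 2 (L2 Ω × L2 Ω))) :=
    hc.preimage (WithLp.prodContinuousLinearEquiv 2 ℂ (L2 Ω) (L2 Ω)).continuous
  exact h.completeSpace_coe

/-- `(u, P u) ↦ u`. -/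
def fstL (P : MvPolynomial (Fin n) ℝ) (Ω : Opens (Space n)) : graphSpace P Ω →L[ℂ] L2 Ω :=
  (ContinuousLinearMap.fst ℂ (L2 Ω) (L2 Ω)).comp
    ((WithLp.prodContinuousLinearEquiv 2 ℂ (L2 Ω) (L2 Ω)).toContinuousLinearMap.comp
      (graphSpace P Ω).subtypeL)

/-- `(u, P u) ↦ P u`. -/
def sndL (P : MvPolynomial (Fin n) ℝ) (Ω : Opens (Space n)) : graphSpace P Ω →L[ℂ] L2 Ω :=
  (ContinuousLinearMap.snd ℂ (L2 Ω) (L2 Ω)).comp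
    ((WithLp.prodContinuousLinearEquiv 2 ℂ (L2 Ω) (L2 Ω)).toContinuousLinearMap.comp
      (graphSpace P Ω).subtypeL)

theorem mem_minGraph_of_graphSpace (u : graphSpace P Ω) :
    (fstL P Ω u, sndL P Ω u) ∈ minGraph P Ω := u.2

theorem norm_sq_graphSpace (u : graphSpace P Ω) :
    ‖u‖ ^ 2 = ‖fstL P Ω u‖ ^ 2 + ‖sndL P Ω u‖ ^ 2 :=
  WithLp.prod_norm_sq_eq_of_L2 (u : WithLp 2 (L2 Ω × L2 Ω))

theorem eq_zero_of_fstL_eq_zero {u : graphSpace P Ω} (h : fstL P Ω u = 0) : u = 0 := by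
  have h2 : sndL P Ω u = 0 := minGraph_single_valued P Ω _ (mem_minGraph_of_graphSpace u) h
  have := norm_sq_graphSpace u
  rw [h, h2] at this
  simpa using this

/-- `(u, P u) ↦ (P - l) u`. -/
def diffL (P : MvPolynomial (Fin n) ℝ) (Ω : Opens (Space n)) (l : ℝ) :
    graphSpace P Ω →L[ℂ] L2 Ω :=
  sndL P Ω - (l : ℂ) • fstL P Ω

theorem diffL_apply (l : ℝ) (u : graphSpace P Ω) :
    diffL P Ω l u = sndL P Ω u - (l : ℂ) • fstL P Ω u := rfl

/-- The self-adjoint operator on the graph space which represents the quadratic form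
`⟪S (P - l) u, (P - l) u⟫ + ⟪(P - l) u, u⟫`. -/
def formOp (P : MvPolynomial (Fin n) ℝ) (Ω : Opens (Space n)) (S : L2 Ω →L[ℂ] L2 Ω) (l : ℝ) :
    graphSpace P Ω →L[ℂ] graphSpace P Ω :=
  (ContinuousLinearMap.adjoint (diffL P Ω l)).comp (S.comp (diffL P Ω l)) +
    (ContinuousLinearMap.adjoint (fstL P Ω)).comp (diffL P Ω l)

theorem inner_formOp (S : L2 Ω →L[ℂ] L2 Ω) (l : ℝ) (u v : graphSpace P Ω) :
    inner ℂ (formOp P Ω S l u) v =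
      inner ℂ (S (diffL P Ω l u)) (diffL P Ω l v) + inner ℂ (diffL P Ω l u) (fstL P Ω v) := by
  simp only [formOp, add_apply, ContinuousLinearMap.comp_apply, inner_add_left,
    ContinuousLinearMap.adjoint_inner_left]

theorem continuous_formOp (S : L2 Ω →L[ℂ] L2 Ω) : Continuous (formOp P Ω S) := by
  have h1 : Continuous (diffL P Ω) :=
    continuous_const.sub (Complex.continuous_ofReal.smul continuous_const)
  have h2 : Continuous fun l => ContinuousLinearMap.adjoint (diffL P Ω l) :=
    (ContinuousLinearMap.adjoint (𝕜 := ℂ) (E := graphSpace P Ω) (F := L2 Ω)).continuous.comp h1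
  exact (h2.clm_comp (continuous_const.clm_comp h1)).add (continuous_const.clm_comp h1)

theorem inner_diffL_fstL_symm (l : ℝ) (u v : graphSpace P Ω) :
    inner ℂ (diffL P Ω l u) (fstL P Ω v) = inner ℂ (fstL P Ω u) (diffL P Ω l v) := by
  have h := inner_symm_of_mem_minGraph (mem_minGraph_of_graphSpace u) (mem_minGraph_of_graphSpace v)
  simp only at h
  rw [diffL_apply, diffL_apply, inner_sub_left, inner_sub_right, h, inner_smul_left,
    inner_smul_right, Complex.conj_ofReal]

theorem re_inner_diffL (l : ℝ) (u : graphSpace P Ω) :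
    (inner ℂ (diffL P Ω l u) (fstL P Ω u)).re =
      (inner ℂ (fstL P Ω u) (sndL P Ω u)).re - l * ‖fstL P Ω u‖ ^ 2 := by
  rw [inner_diffL_fstL_symm, diffL_apply, inner_sub_right, inner_smul_right,
    inner_self_eq_norm_sq_to_K, Complex.sub_re, Complex.re_ofReal_mul]
  congr 2
  norm_cast

theorem formOp_symm {S : L2 Ω →L[ℂ] L2 Ω} (hS : ∀ f g, inner ℂ (S f) g = inner ℂ f (S g)) (l : ℝ)
    (u v : graphSpace P Ω) :
    inner ℂ (formOp P Ω S l u) v = inner ℂ u (formOp P Ω S l v) := by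
  rw [← inner_conj_symm u, inner_formOp, inner_formOp, map_add, inner_conj_symm, inner_conj_symm,
    hS, inner_diffL_fstL_symm]

theorem finite_rank_estimate_graphSpace (hΩ : Bornology.IsBounded (Ω : Set (Space n)))
    (hP : Tendsto (symbolTilde P) (cocompact (Space n)) atTop) {ε : ℝ} (hε : 0 < ε) :
    ∃ (k : ℕ) (T : L2 Ω →L[ℂ] EuclideanSpace ℂ (Fin k)), ∀ u : graphSpace P Ω,
      ‖fstL P Ω u‖ ^ 2 ≤ ε * ‖u‖ ^ 2 + ‖T (fstL P Ω u)‖ ^ 2 := by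
  obtain ⟨k, T, hT⟩ := exists_finite_rank_estimate hΩ hP hε
  refine ⟨k, T, fun u => ?_⟩
  have h := mem_of_mem_minGraph (P := P) (S := {z : L2 Ω × L2 Ω |
    ‖z.1‖ ^ 2 ≤ ε * ‖z.2‖ ^ 2 + ε * ‖z.1‖ ^ 2 + ‖T z.1‖ ^ 2})
    (isClosed_le (by fun_prop) (by fun_prop)) (fun φ => by rw [mem_ofPred_eq]; exact hT φ)
    (mem_minGraph_of_graphSpace u)
  change ‖fstL P Ω u‖ ^ 2 ≤ ε * ‖sndL P Ω u‖ ^ 2 + ε * ‖fstL P Ω u‖ ^ 2 +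
    ‖T (fstL P Ω u)‖ ^ 2 at h
  rw [norm_sq_graphSpace]
  linarith

/-- With `f = (P - l) u` and `m = 1 / M`, the form is at least `m ‖f‖² - ‖f‖ ‖u‖`, hence at least
`m/4` times the squared graph norm minus `K ‖u‖²` in `L²`. Compactness absorbs the last term up to
finite rank, leaving `m/8`. -/
theorem formOp_bounded_below_mod_finite_rank (hΩ : Bornology.IsBounded (Ω : Set (Space n)))
    (hP : Tendsto (symbolTilde P) (cocompact (Space n)) atTop) {S : L2 Ω →L[ℂ] L2 Ω} {M : ℝ}
    (hM : 0 < M) (hS : ∀ f, M⁻¹ * ‖f‖ ^ 2 ≤ (inner ℂ (S f) f).re) (l : ℝ) :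
    ∃ (k : ℕ) (T : graphSpace P Ω →L[ℂ] EuclideanSpace ℂ (Fin k)) (c : ℝ), 0 < c ∧
      ∀ u, c * ‖u‖ ^ 2 ≤ (inner ℂ (formOp P Ω S l u) u).re + ‖T u‖ ^ 2 := by
  set m := M⁻¹ with hm
  have hm0 : 0 < m := by positivity
  set K : ℝ := m / 4 + l ^ 2 * m / 2 + M / 2 with hK
  have hK0 : 0 < K := by positivity
  obtain ⟨k, T, hT⟩ := finite_rank_estimate_graphSpace (P := P) hΩ hP
    (show 0 < m / (8 * K) by positivity)
  refine ⟨k, ((Real.sqrt K : ℝ) : ℂ) • T.comp (fstL P Ω), m / 8, by positivity, fun u => ?_⟩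
  have h1 := hS (diffL P Ω l u)
  set f := diffL P Ω l u with hf
  set a := fstL P Ω u with ha
  have h2 : -(‖f‖ * ‖a‖) ≤ (inner ℂ f a).re :=
    (abs_le.1 ((Complex.abs_re_le_norm _).trans (norm_inner_le_norm f a))).1
  have h3 : ‖sndL P Ω u‖ ≤ ‖f‖ + |l| * ‖a‖ := by
    have : sndL P Ω u = f + (l : ℂ) • a := by rw [hf, diffL_apply, ← ha, sub_add_cancel]
    rw [this]
    refine (norm_add_le _ _).trans_eq ?_
    rw [norm_smul, Complex.norm_real, Real.norm_eq_abs]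
  have h4 : ‖sndL P Ω u‖ ^ 2 ≤ 2 * ‖f‖ ^ 2 + 2 * l ^ 2 * ‖a‖ ^ 2 := by
    calc _ ≤ (‖f‖ + |l| * ‖a‖) ^ 2 := by gcongr
      _ ≤ 2 * ‖f‖ ^ 2 + 2 * (|l| * ‖a‖) ^ 2 := by nlinarith [sq_nonneg (‖f‖ - |l| * ‖a‖)]
      _ = _ := by rw [mul_pow, sq_abs]; ring
  have h5 : ‖f‖ * ‖a‖ ≤ m / 2 * ‖f‖ ^ 2 + M / 2 * ‖a‖ ^ 2 := by
    have hmM : m * M = 1 := inv_mul_cancel₀ hM.ne'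
    have : 0 ≤ m / 2 * (‖f‖ - M * ‖a‖) ^ 2 := by positivity
    have e : m / 2 * (‖f‖ - M * ‖a‖) ^ 2 =
        m / 2 * ‖f‖ ^ 2 - (m * M) * (‖f‖ * ‖a‖) + (m * M) * M / 2 * ‖a‖ ^ 2 := by ring
    rw [e, hmM] at this
    linarith
  have h6 := norm_sq_graphSpace u
  have h7 : K * ‖a‖ ^ 2 ≤ m / 8 * ‖u‖ ^ 2 + K * ‖T a‖ ^ 2 := by
    calc _ ≤ K * (m / (8 * K) * ‖u‖ ^ 2 + ‖T a‖ ^ 2) := by gcongr; exact hT u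
      _ = _ := by field_simp
  have h8 : ‖(((Real.sqrt K : ℝ) : ℂ) • T.comp (fstL P Ω)) u‖ ^ 2 = K * ‖T a‖ ^ 2 := by
    rw [smul_apply, norm_smul, mul_pow, Complex.norm_real, Real.norm_eq_abs, sq_abs,
      Real.sq_sqrt hK0.le]
    rfl
  rw [h8, inner_formOp, Complex.add_re]
  rw [← ha] at h6
  have h9 : m / 4 * ‖sndL P Ω u‖ ^ 2 ≤ m / 4 * (2 * ‖f‖ ^ 2 + 2 * l ^ 2 * ‖a‖ ^ 2) := by gcongr
  have h10 : K * ‖a‖ ^ 2 = m / 4 * ‖a‖ ^ 2 + l ^ 2 * m / 2 * ‖a‖ ^ 2 + M / 2 * ‖a‖ ^ 2 := by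
    rw [hK]; ring
  rw [h6] at h7 ⊢
  linarith

theorem formOp_pos_of_bounded_below {S : L2 Ω →L[ℂ] L2 Ω} (hS : ∀ f, 0 ≤ (inner ℂ (S f) f).re)
    {c : ℝ} (hc : ∀ ξ, c ≤ symbol P ξ) {l : ℝ} (hl : l < c) (u : graphSpace P Ω) (hu : u ≠ 0) :
    0 < (inner ℂ (formOp P Ω S l u) u).re := by
  have h1 := hS (diffL P Ω l u)
  have h2 := re_inner_ge_of_mem_minGraph hc (mem_minGraph_of_graphSpace u)
  simp only at h2
  have h3 : 0 < ‖fstL P Ω u‖ ^ 2 := by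
    have : fstL P Ω u ≠ 0 := fun h => hu (eq_zero_of_fstL_eq_zero h)
    positivity
  have h4 := re_inner_diffL l u
  rw [inner_formOp, Complex.add_re, h4]
  nlinarith

/-- Since `⟪(P - l) u, u⟫ ≤ -(c + l) ‖u‖²`, Cauchy–Schwarz gives `‖(P - l) u‖ ≥ (c + l) ‖u‖ > M
‖u‖`. Then the quadratic term of the form dominates the indefinite one. -/
theorem formOp_pos_of_neg_bounded_below {S : L2 Ω →L[ℂ] L2 Ω} {M : ℝ} (hM : 0 < M)
    (hS : ∀ f, M⁻¹ * ‖f‖ ^ 2 ≤ (inner ℂ (S f) f).re)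
    {c : ℝ} (hc : ∀ ξ, c ≤ -symbol P ξ) {l : ℝ} (hl : M - c < l) (u : graphSpace P Ω) (hu : u ≠ 0) :
    0 < (inner ℂ (formOp P Ω S l u) u).re := by
  have h1 := hS (diffL P Ω l u)
  have h2 := re_inner_le_of_mem_minGraph hc (mem_minGraph_of_graphSpace u)
  simp only at h2
  have h3 : 0 < ‖fstL P Ω u‖ := by
    have : fstL P Ω u ≠ 0 := fun h => hu (eq_zero_of_fstL_eq_zero h)
    positivity
  have h4 := re_inner_diffL l u
  have h5 : -(‖diffL P Ω l u‖ * ‖fstL P Ω u‖) ≤ (inner ℂ (diffL P Ω l u) (fstL P Ω u)).re :=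
    (abs_le.1 ((Complex.abs_re_le_norm _).trans (norm_inner_le_norm _ _))).1
  set f := diffL P Ω l u
  set a := fstL P Ω u
  have h6 : (c + l) * ‖a‖ ≤ ‖f‖ := by
    refine le_of_mul_le_mul_right ?_ h3
    nlinarith
  have h7 : M * ‖a‖ < ‖f‖ := lt_of_lt_of_le (by gcongr; linarith) h6
  have h8 : ‖a‖ < M⁻¹ * ‖f‖ := by
    rw [inv_mul_eq_div, lt_div_iff₀ hM]; linarith
  have h9 : 0 < ‖f‖ := lt_of_le_of_lt (by positivity) h7
  rw [inner_formOp, Complex.add_re]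
  nlinarith

/-- At `l = δ / 2` the terms in `⟪u, P u⟫` cancel once `S` is replaced by its upper bound `δ⁻¹`,
leaving `δ⁻¹ ‖P u‖² - (δ / 4) ‖u‖²`. -/
theorem formOp_nonpos {S : L2 Ω →L[ℂ] L2 Ω} {δ : ℝ} (hδ : 0 < δ)
    (hS : ∀ f, (inner ℂ (S f) f).re ≤ δ⁻¹ * ‖f‖ ^ 2) (u : graphSpace P Ω)
    (hu : 2 * ‖sndL P Ω u‖ ≤ δ * ‖fstL P Ω u‖) :
    (inner ℂ (formOp P Ω S (δ / 2) u) u).re ≤ 0 := by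
  have h1 := hS (diffL P Ω (δ / 2) u)
  have h2 := re_inner_diffL (δ / 2) u
  have h3 : ‖diffL P Ω (δ / 2) u‖ ^ 2 = ‖sndL P Ω u‖ ^ 2 -
      δ * (inner ℂ (fstL P Ω u) (sndL P Ω u)).re + δ ^ 2 / 4 * ‖fstL P Ω u‖ ^ 2 := by
    rw [diffL_apply, norm_sub_sq (𝕜 := ℂ), inner_smul_right, norm_smul, Complex.norm_real, mul_pow,
      Real.norm_eq_abs, sq_abs, ← inner_conj_symm]
    simp only [RCLike.re_to_complex, Complex.re_ofReal_mul, Complex.conj_re]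
    ring
  rw [inner_formOp, Complex.add_re, h2]
  rw [h3] at h1
  set s := ‖sndL P Ω u‖
  set a := ‖fstL P Ω u‖
  set r := (inner ℂ (fstL P Ω u) (sndL P Ω u)).re
  have h4 : δ⁻¹ * (s ^ 2 - δ * r + δ ^ 2 / 4 * a ^ 2) = δ⁻¹ * s ^ 2 - r + δ / 4 * a ^ 2 := by
    field_simp
  have h5 : δ⁻¹ * s ^ 2 ≤ δ / 4 * a ^ 2 := by
    rw [inv_mul_le_iff₀ hδ]
    have : (2 * s) ^ 2 ≤ (δ * a) ^ 2 := by gcongr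
    nlinarith
  linarith

/-! ### Weak solutions and the graph space -/

theorem weakSol_iff {V : Space n → ℝ}
    (hV : MemLp (fun x => (V x : ℂ)) ⊤ (volume.restrict (Ω : Set (Space n)))) (l : ℝ)
    {g : Space n → ℂ} {G : L2 Ω} (hg : g =ᵐ[volume.restrict (Ω : Set (Space n))] G) :
    WeakSol P Ω V (l : ℂ) g ↔ ∀ φ : 𝓓(Ω, ℂ),
      inner ℂ (testToL2 Ω (polyOp P Ω φ) + mulL2 hV (testToL2 Ω φ) - (l : ℂ) • testToL2 Ω φ) G =
        0 := by
  refine forall_congr' fun φ => ?_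
  set ψ := testToL2 Ω (polyOp P Ω φ) + mulL2 hV (testToL2 Ω φ) - (l : ℂ) • testToL2 Ω φ with hψ
  have hae : (fun x => g x * starRingEnd ℂ
      (polyOp P Ω φ x + (V x : ℂ) * φ x - starRingEnd ℂ (l : ℂ) * φ x))
      =ᵐ[volume.restrict (Ω : Set (Space n))] fun x => inner ℂ (ψ x) (G x) := by
    filter_upwards [hg, coeFn_testToL2 φ, coeFn_testToL2 (polyOp P Ω φ),
      coeFn_mulL2 hV (testToL2 Ω φ), Lp.coeFn_smul (l : ℂ) (testToL2 Ω φ),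
      Lp.coeFn_add (testToL2 Ω (polyOp P Ω φ)) (mulL2 hV (testToL2 Ω φ)),
      Lp.coeFn_sub (testToL2 Ω (polyOp P Ω φ) + mulL2 hV (testToL2 Ω φ))
        ((l : ℂ) • testToL2 Ω φ)] with x e1 e2 e3 e4 e5 e6 e7
    rw [hψ, e7, Pi.sub_apply, e6, Pi.add_apply, e5, Pi.smul_apply, e4, e3, e2, e1,
      RCLike.inner_apply', smul_eq_mul, Complex.conj_ofReal, mul_comm]
  rw [MeasureTheory.L2.inner_def, ← integral_congr_ae hae]
  exact and_iff_right ((MeasureTheory.L2.integrable_inner ψ G).congr hae.symm)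

theorem minOp_mem_minGraph (u : H0 P Ω) : ((u : L2 Ω), minOp P Ω u) ∈ minGraph P Ω :=
  Submodule.mem_graph_toLinearPMap (fun z hz h => minGraph_single_valued P Ω z hz h) u

/-- `H₀^P(Ω)` is isomorphic to the graph of `minOp P Ω`. -/
def graphEquiv (P : MvPolynomial (Fin n) ℝ) (Ω : Opens (Space n)) : H0 P Ω ≃ₗ[ℂ] graphSpace P Ω :=
  LinearEquiv.ofBijective
    { toFun := fun u => ⟨WithLp.toLp 2 ((u : L2 Ω), minOp P Ω u), minOp_mem_minGraph u⟩
      map_add' := fun u v => Subtype.ext (congrArg (WithLp.toLp 2)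
        (Prod.ext rfl (LinearPMap.map_add _ u v)))
      map_smul' := fun c u => Subtype.ext (congrArg (WithLp.toLp 2)
        (Prod.ext rfl (LinearPMap.map_smul _ c u))) } <| by
    constructor
    · intro u v h
      exact Subtype.ext (congrArg (fun z => fstL P Ω z) h)
    · intro z
      have hz := mem_minGraph_of_graphSpace z
      refine ⟨⟨fstL P Ω z, (fstL P Ω z, sndL P Ω z), hz, rfl⟩, ?_⟩
      rw [← sub_eq_zero]
      refine eq_zero_of_fstL_eq_zero ?_
      rw [map_sub, sub_eq_zero]
      rfl

theorem fstL_graphEquiv (u : H0 P Ω) : fstL P Ω (graphEquiv P Ω u) = u := rfl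

theorem sndL_graphEquiv (u : H0 P Ω) : sndL P Ω (graphEquiv P Ω u) = minOp P Ω u := rfl

/-- A test function, regarded as an element of the graph space. -/
def testGraph (P : MvPolynomial (Fin n) ℝ) (φ : 𝓓(Ω, ℂ)) : graphSpace P Ω :=
  ⟨WithLp.toLp 2 (testToL2 Ω φ, testToL2 Ω (polyOp P Ω φ)),
    Submodule.le_topologicalClosure _ ⟨φ, rfl⟩⟩

/-- Test functions are dense in the graph space by its definition as a closure. -/
theorem eq_zero_of_inner_testGraph {w : graphSpace P Ω}
    (h : ∀ φ : 𝓓(Ω, ℂ), inner ℂ w (testGraph P φ) = 0) : w = 0 := by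
  have key : inner ℂ (fstL P Ω w) (fstL P Ω w) + inner ℂ (sndL P Ω w) (sndL P Ω w) = (0 : ℂ) :=
    mem_of_mem_minGraph (P := P) (S := {z : L2 Ω × L2 Ω |
      inner ℂ (fstL P Ω w) z.1 + inner ℂ (sndL P Ω w) z.2 = (0 : ℂ)})
      (isClosed_eq (by fun_prop) (by fun_prop)) (fun φ => h φ) (mem_minGraph_of_graphSpace w)
  exact inner_self_eq_zero.1 (show inner ℂ w w = (0 : ℂ) from key)

/-! ### The potential: kernels of the form and transmission eigenvalues -/

section Potential

variable {V : Space n → ℝ} {δ : ℝ}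

theorem memLp_inv_of_ae_ge (hV : AEStronglyMeasurable V (volume.restrict (Ω : Set (Space n))))
    (hδ : 0 < δ) (hVδ : ∀ᵐ x ∂(volume.restrict (Ω : Set (Space n))), δ ≤ V x) :
    MemLp (fun x => ((V x : ℂ))⁻¹) ⊤ (volume.restrict (Ω : Set (Space n))) := by
  refine memLp_top_of_bound ?_ δ⁻¹ ?_
  · exact (Complex.measurable_ofReal.comp_aemeasurable hV.aemeasurable).inv.aestronglyMeasurable
  · filter_upwards [hVδ] with x hx
    rw [norm_inv, Complex.norm_real, Real.norm_of_nonneg (hδ.le.trans hx)]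
    gcongr

theorem inner_mulL2_inv_symm
    (hVi : MemLp (fun x => ((V x : ℂ))⁻¹) ⊤ (volume.restrict (Ω : Set (Space n)))) (f g : L2 Ω) :
    inner ℂ (mulL2 hVi f) g = inner ℂ f (mulL2 hVi g) := by
  rw [MeasureTheory.L2.inner_def, MeasureTheory.L2.inner_def]
  refine integral_congr_ae ?_
  filter_upwards [coeFn_mulL2 hVi f, coeFn_mulL2 hVi g] with x e1 e2
  rw [e1, e2, RCLike.inner_apply', RCLike.inner_apply', map_mul, map_inv₀, Complex.conj_ofReal]
  ring

theorem inner_mulL2_mulL2_inv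
    (hVi : MemLp (fun x => ((V x : ℂ))⁻¹) ⊤ (volume.restrict (Ω : Set (Space n))))
    (hV : MemLp (fun x => (V x : ℂ)) ⊤ (volume.restrict (Ω : Set (Space n))))
    (hVpos : ∀ᵐ x ∂(volume.restrict (Ω : Set (Space n))), 0 < V x) (f g : L2 Ω) :
    inner ℂ (mulL2 hV f) (mulL2 hVi g) = inner ℂ f g := by
  rw [MeasureTheory.L2.inner_def, MeasureTheory.L2.inner_def]
  refine integral_congr_ae ?_
  filter_upwards [coeFn_mulL2 hV f, coeFn_mulL2 hVi g, hVpos] with x e1 e2 e3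
  have : (V x : ℂ) ≠ 0 := by exact_mod_cast e3.ne'
  rw [e1, e2, RCLike.inner_apply', RCLike.inner_apply', map_mul, Complex.conj_ofReal]
  field_simp

theorem re_inner_mulL2_inv
    (hVi : MemLp (fun x => ((V x : ℂ))⁻¹) ⊤ (volume.restrict (Ω : Set (Space n)))) (f : L2 Ω) :
    Integrable (fun x => (V x)⁻¹ * ‖f x‖ ^ 2) (volume.restrict (Ω : Set (Space n))) ∧
    (inner ℂ (mulL2 hVi f) f).re = ∫ x in (Ω : Set (Space n)), (V x)⁻¹ * ‖f x‖ ^ 2 := by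
  have hae : (fun x => inner ℂ (mulL2 hVi f x) (f x)) =ᵐ[volume.restrict (Ω : Set (Space n))]
      fun x => (((V x)⁻¹ * ‖f x‖ ^ 2 : ℝ) : ℂ) := by
    filter_upwards [coeFn_mulL2 hVi f] with x e1
    rw [e1, RCLike.inner_apply', map_mul, map_inv₀, Complex.conj_ofReal, mul_assoc,
      Complex.conj_mul']
    push_cast
    rfl
  constructor
  · have h := ((MeasureTheory.L2.integrable_inner (𝕜 := ℂ) (mulL2 hVi f) f).congr hae).re
    exact h
  · rw [MeasureTheory.L2.inner_def, integral_congr_ae hae, integral_complex_ofReal,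
      Complex.ofReal_re]

theorem norm_sq_L2 (f : L2 Ω) :
    Integrable (fun x => ‖f x‖ ^ 2) (volume.restrict (Ω : Set (Space n))) ∧
    ‖f‖ ^ 2 = ∫ x in (Ω : Set (Space n)), ‖f x‖ ^ 2 := by
  constructor
  · exact (Lp.memLp f).integrable_norm_pow (by norm_num)
  · have h := inner_self_eq_norm_sq_to_K (𝕜 := ℂ) f
    rw [MeasureTheory.L2.inner_def] at h
    simp only [RCLike.inner_apply', Complex.conj_mul'] at h
    norm_cast at h
    exact (Complex.ofReal_injective h).symm

theorem re_inner_mulL2_inv_le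
    (hVi : MemLp (fun x => ((V x : ℂ))⁻¹) ⊤ (volume.restrict (Ω : Set (Space n))))
    (hδ : 0 < δ) (hVδ : ∀ᵐ x ∂(volume.restrict (Ω : Set (Space n))), δ ≤ V x) (f : L2 Ω) :
    (inner ℂ (mulL2 hVi f) f).re ≤ δ⁻¹ * ‖f‖ ^ 2 := by
  rw [(re_inner_mulL2_inv hVi f).2, (norm_sq_L2 f).2, ← integral_const_mul]
  refine integral_mono_ae (re_inner_mulL2_inv hVi f).1 ((norm_sq_L2 f).1.const_mul _) ?_
  filter_upwards [hVδ] with x hx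
  gcongr

theorem le_re_inner_mulL2_inv
    (hVi : MemLp (fun x => ((V x : ℂ))⁻¹) ⊤ (volume.restrict (Ω : Set (Space n)))) {M : ℝ}
    (hVM : ∀ᵐ x ∂(volume.restrict (Ω : Set (Space n))), 0 < V x ∧ V x ≤ M) (f : L2 Ω) :
    M⁻¹ * ‖f‖ ^ 2 ≤ (inner ℂ (mulL2 hVi f) f).re := by
  rw [(re_inner_mulL2_inv hVi f).2, (norm_sq_L2 f).2, ← integral_const_mul]
  refine integral_mono_ae ((norm_sq_L2 f).1.const_mul _) (re_inner_mulL2_inv hVi f).1 ?_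
  filter_upwards [hVM] with x hx
  have := hx.1
  gcongr
  exact hx.2

theorem innerFactor_ae_eq
    (hVi : MemLp (fun x => ((V x : ℂ))⁻¹) ⊤ (volume.restrict (Ω : Set (Space n)))) (l : ℝ)
    (u : H0 P Ω) : innerFactor P Ω V (l : ℂ) u =ᵐ[volume.restrict (Ω : Set (Space n))]
      mulL2 hVi (diffL P Ω l (graphEquiv P Ω u)) := by
  rw [diffL_apply, fstL_graphEquiv, sndL_graphEquiv]
  filter_upwards [coeFn_mulL2 hVi (minOp P Ω u - (l : ℂ) • (u : L2 Ω)),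
    Lp.coeFn_sub (minOp P Ω u) ((l : ℂ) • (u : L2 Ω)), Lp.coeFn_smul (l : ℂ) (u : L2 Ω)]
    with x e1 e2 e3
  rw [e1, e2, Pi.sub_apply, e3]
  rfl

/-- Testing `T_l u = 0` on `φ`, the factor `V` cancels `V⁻¹` and the conjugate of the form's pairing
of `u` with `φ` appears; density of test functions does the rest. -/
theorem mem_kerT_iff
    (hVi : MemLp (fun x => ((V x : ℂ))⁻¹) ⊤ (volume.restrict (Ω : Set (Space n))))
    (hV : MemLp (fun x => (V x : ℂ)) ⊤ (volume.restrict (Ω : Set (Space n))))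
    (hVpos : ∀ᵐ x ∂(volume.restrict (Ω : Set (Space n))), 0 < V x) (l : ℝ) (u : H0 P Ω) :
    u ∈ kerT P Ω V (l : ℂ) ↔ formOp P Ω (mulL2 hVi) l (graphEquiv P Ω u) = 0 := by
  change WeakSol P Ω V (l : ℂ) _ ↔ _
  rw [weakSol_iff hV l (innerFactor_ae_eq hVi l u)]
  have h : ∀ φ : 𝓓(Ω, ℂ), inner ℂ (testToL2 Ω (polyOp P Ω φ) + mulL2 hV (testToL2 Ω φ) -
      (l : ℂ) • testToL2 Ω φ) (mulL2 hVi (diffL P Ω l (graphEquiv P Ω u))) =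
      starRingEnd ℂ (inner ℂ (formOp P Ω (mulL2 hVi) l (graphEquiv P Ω u)) (testGraph P φ)) := by
    intro φ
    have h1 : diffL P Ω l (testGraph P φ) =
        testToL2 Ω (polyOp P Ω φ) - (l : ℂ) • testToL2 Ω φ := rfl
    have h2 : fstL P Ω (testGraph P φ) = testToL2 Ω φ := rfl
    rw [inner_formOp, map_add, inner_conj_symm, inner_conj_symm, h1, h2, add_sub_right_comm,
      inner_add_left, inner_mulL2_mulL2_inv hVi hV hVpos]
  simp only [h, map_eq_zero]
  exact ⟨eq_zero_of_inner_testGraph, fun h0 φ => by rw [h0, inner_zero_left]⟩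

theorem multiplicity_eq_finrank_ker
    (hVi : MemLp (fun x => ((V x : ℂ))⁻¹) ⊤ (volume.restrict (Ω : Set (Space n))))
    (hV : MemLp (fun x => (V x : ℂ)) ⊤ (volume.restrict (Ω : Set (Space n))))
    (hVpos : ∀ᵐ x ∂(volume.restrict (Ω : Set (Space n))), 0 < V x) (l : ℝ) :
    multiplicity P Ω V l = Module.finrank ℂ (formOp P Ω (mulL2 hVi) l).ker := by
  have h : (kerT P Ω V (l : ℂ)).map (graphEquiv P Ω).toLinearMap =
      (formOp P Ω (mulL2 hVi) l).ker := by
    ext z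
    obtain ⟨u, rfl⟩ := (graphEquiv P Ω).surjective z
    rw [LinearMap.mem_ker]
    refine Iff.trans ?_ (mem_kerT_iff hVi hV hVpos l u)
    exact ⟨fun ⟨v, hv, hvu⟩ => (graphEquiv P Ω).injective hvu ▸ hv, fun hu => ⟨u, hu, rfl⟩⟩
  rw [multiplicity, ← h]
  exact (LinearEquiv.finrank_map_eq (graphEquiv P Ω) _).symm

/-- The pair is `w = V⁻¹ (P - l) u` and `v = w + u`. Here `v = 0` would mean `(P - l) u = -V u`, and
`w = 0` would mean `(P - l) u = 0`; unique continuation excludes both. -/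
theorem isTransmissionEigenvalue_of_mem_kerT (hΩ : Bornology.IsBounded (Ω : Set (Space n)))
    (hP : 1 ≤ P.totalDegree)
    (hVi : MemLp (fun x => ((V x : ℂ))⁻¹) ⊤ (volume.restrict (Ω : Set (Space n))))
    (hV : MemLp (fun x => (V x : ℂ)) ⊤ (volume.restrict (Ω : Set (Space n)))) {M : ℝ}
    (hVM : ∀ᵐ x ∂(volume.restrict (Ω : Set (Space n))), 0 < V x ∧ V x ≤ M) {l : ℝ} {u : H0 P Ω}
    (hu : u ∈ kerT P Ω V (l : ℂ)) (hu0 : u ≠ 0) : IsTransmissionEigenvalue P Ω V (l : ℂ) := by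
  set D : L2 Ω := diffL P Ω l (graphEquiv P Ω u) with hD
  set w : L2 Ω := mulL2 hVi D with hw
  have hL2 : ∀ f : L2 Ω, L2Loc Ω f := fun f K _ hKΩ =>
    (Lp.memLp f).mono_measure (Measure.restrict_mono hKΩ le_rfl)
  have hne : ∀ M, ¬ ∀ᵐ x ∂(volume.restrict (Ω : Set (Space n))), ‖D x‖ ≤ M * ‖(u : L2 Ω) x‖ := by
    intro M h
    exact hu0 (Subtype.ext (eq_zero_of_mem_minGraph_of_norm_le hΩ hP (minOp_mem_minGraph u) l M h))
  have hwsol : WeakSol P Ω V (l : ℂ) w := hu.congr (innerFactor_ae_eq hVi l u).symm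
  refine ⟨(w + (u : L2 Ω) : L2 Ω), w, hL2 _, hL2 _, fun h => hne M ?_, fun h => hne 0 ?_, ?_, hwsol,
    u, ?_⟩
  · filter_upwards [h, Lp.coeFn_add w (u : L2 Ω), coeFn_mulL2 hVi D, hVM] with x e1 e2 e3 e4
    rw [e2, Pi.add_apply, hw, e3] at e1
    have hVx : (V x : ℂ) ≠ 0 := by exact_mod_cast e4.1.ne'
    have e5 : D x = -((V x : ℂ) * (u : L2 Ω) x) := by
      have := congrArg (fun t => (V x : ℂ) * t) e1
      simp only [Pi.zero_apply, mul_zero, mul_add, mul_inv_cancel_left₀ hVx] at this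
      exact eq_neg_of_add_eq_zero_left this
    rw [e5, norm_neg, norm_mul, Complex.norm_real, Real.norm_of_nonneg e4.1.le]
    gcongr
    exact e4.2
  · filter_upwards [h, coeFn_mulL2 hVi D, hVM] with x e1 e3 e4
    rw [hw, e3] at e1
    have hVx : (V x : ℂ) ≠ 0 := by exact_mod_cast e4.1.ne'
    rw [(mul_eq_zero.1 e1).resolve_left (inv_ne_zero hVx)]
    simp
  · have hV0 : MemLp (fun x => (((0 : Space n → ℝ) x : ℝ) : ℂ)) ⊤
        (volume.restrict (Ω : Set (Space n))) := by
      simp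
    have h0 : ∀ f, mulL2 hV0 f = 0 := by
      intro f
      refine Lp.eq_zero_iff_ae_eq_zero.2 ?_
      filter_upwards [coeFn_mulL2 hV0 f] with x hx
      rw [hx]
      simp
    rw [weakSol_iff hV0 l (ae_eq_refl _)]
    intro φ
    -- The equation for `w` reads `⟪(P - l) φ, w⟫ + ⟪φ, D⟫ = 0`. By symmetry of `P` the second term
    -- is `⟪(P - l) φ, u⟫`, so `w + u` solves the equation without potential.
    have h1 := (weakSol_iff hV l (ae_eq_refl _)).1 hwsol φ
    rw [add_sub_right_comm, inner_add_left, hw,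
      inner_mulL2_mulL2_inv hVi hV (hVM.mono fun x hx => hx.1)] at h1
    have h2 := inner_diffL_fstL_symm l (testGraph P φ) (graphEquiv P Ω u)
    change inner ℂ (testToL2 Ω (polyOp P Ω φ) - (l : ℂ) • testToL2 Ω φ) (u : L2 Ω) =
      inner ℂ (testToL2 Ω φ) D at h2
    rw [h0, add_zero, inner_add_right, h2, h1]
  · filter_upwards [Lp.coeFn_add w (u : L2 Ω)] with x hx
    rw [Pi.sub_apply, hx, Pi.add_apply, add_sub_cancel_left]

end Potential

end

end TransmissionProblem


/-! ### Assembly of the spectral flow argument -/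

theorem lemma4p4 {n : ℕ} (P : MvPolynomial (Fin n) ℝ) (hP : 2 ≤ P.totalDegree)
    (hPinf : Filter.Tendsto (TransmissionProblem.symbolTilde P)
      (Filter.cocompact (EuclideanSpace ℝ (Fin n))) Filter.atTop)
    (hPbdd : (∃ c : ℝ, ∀ ξ, c ≤ TransmissionProblem.symbol P ξ) ∨
      (∃ c : ℝ, ∀ ξ, c ≤ -TransmissionProblem.symbol P ξ))
    (Ω : TopologicalSpace.Opens (EuclideanSpace ℝ (Fin n)))
    (hΩc : IsConnected (Ω : Set (EuclideanSpace ℝ (Fin n))))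
    (hΩb : Bornology.IsBounded (Ω : Set (EuclideanSpace ℝ (Fin n))))
    (V : EuclideanSpace ℝ (Fin n) → ℝ) (hV : MemLp V ⊤ volume)
    (hVsupp : TransmissionProblem.essSupport V = closure (Ω : Set (EuclideanSpace ℝ (Fin n))))
    (δ : ℝ) (hδ : 0 < δ)
    (hVδ : ∀ᵐ x ∂(volume.restrict (closure (Ω : Set (EuclideanSpace ℝ (Fin n))))), δ ≤ V x)
    (p : ℕ) (W : Submodule ℂ (TransmissionProblem.H0 P Ω)) (hWp : Module.finrank ℂ W = p)
    (hW : ∀ u ∈ W, u ≠ 0 →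
      2 * (‖TransmissionProblem.minOp P Ω u‖ /
        ‖(u : TransmissionProblem.L2 Ω)‖) ≤ δ) :
    ∃ ev : Fin p → ℝ,
      (∀ i, TransmissionProblem.IsTransmissionEigenvalue P Ω V (ev i : ℂ)) ∧
      ∀ i, (Finset.univ.filter fun j => ev j = ev i).card ≤
        TransmissionProblem.multiplicity P Ω V (ev i) := by
  open TransmissionProblem in
  have hVδ' : ∀ᵐ x ∂(volume.restrict (Ω : Set (Space n))), δ ≤ V x :=
    ae_restrict_of_ae_restrict_of_subset subset_closure hVδ
  have hVpos : ∀ᵐ x ∂(volume.restrict (Ω : Set (Space n))), 0 < V x :=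
    hVδ'.mono fun x hx => hδ.trans_le hx
  have hVr : MemLp V ⊤ (volume.restrict (Ω : Set (Space n))) := hV.restrict _
  have hVC : MemLp (fun x => (V x : ℂ)) ⊤ (volume.restrict (Ω : Set (Space n))) := hVr.ofReal
  have hVi := memLp_inv_of_ae_ge hVr.1 hδ hVδ'
  obtain ⟨M, hM, hVM⟩ : ∃ M : ℝ, 0 < M ∧
      ∀ᵐ x ∂(volume.restrict (Ω : Set (Space n))), 0 < V x ∧ V x ≤ M := by
    refine ⟨(eLpNormEssSup V (volume.restrict (Ω : Set (Space n)))).toReal + 1, by positivity, ?_⟩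
    have hfin : eLpNormEssSup V (volume.restrict (Ω : Set (Space n))) ≠ ⊤ := by
      have := hVr.2.ne
      rwa [eLpNorm_exponent_top] at this
    filter_upwards [hVpos, enorm_ae_le_eLpNormEssSup V (volume.restrict (Ω : Set (Space n)))]
      with x h1 h2
    refine ⟨h1, ?_⟩
    have h3 := ENNReal.toReal_mono hfin h2
    rw [toReal_enorm, Real.norm_of_nonneg h1.le] at h3
    linarith
  have hSlow := le_re_inner_mulL2_inv hVi hVM
  have hS0 : ∀ f, 0 ≤ (inner ℂ (mulL2 hVi f) f).re := fun f =>
    le_trans (by positivity) (hSlow f)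
  set A := formOp P Ω (mulL2 hVi) with hA
  have hAc : Continuous A := continuous_formOp _
  have hAs : ∀ l x y, inner ℂ (A l x) y = inner ℂ x (A l y) := fun l =>
    formOp_symm (inner_mulL2_inv_symm hVi) l
  have hAT := formOp_bounded_below_mod_finite_rank hΩb hPinf hM hSlow
  have hW' : ∀ z ∈ W.map (graphEquiv P Ω).toLinearMap, (inner ℂ (A (δ / 2) z) z).re ≤ 0 := by
    rintro _ ⟨u, hu, rfl⟩
    refine formOp_nonpos hδ (re_inner_mulL2_inv_le hVi hδ hVδ') _ ?_
    change 2 * ‖minOp P Ω u‖ ≤ δ * ‖(u : L2 Ω)‖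
    rcases eq_or_ne u 0 with rfl | hu0
    · simp
    · have h1 : 0 < ‖(u : L2 Ω)‖ := norm_pos_iff.2 fun h => hu0 (Subtype.ext h)
      have h2 := hW u hu hu0
      rwa [← mul_div_assoc, div_le_iff₀ h1] at h2
  have hWp' : Module.finrank ℂ (W.map (graphEquiv P Ω).toLinearMap) = p := by
    rw [← hWp]; exact LinearEquiv.finrank_map_eq (graphEquiv P Ω) W
  have hev : ∃ ev : Fin p → ℝ, ∀ i, (Finset.univ.filter fun j => ev j = ev i).card ≤
      Module.finrank ℂ (A (ev i)).ker := by
    rcases hPbdd with ⟨c, hc⟩ | ⟨c, hc⟩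
    · exact exists_kernels_of_path hAc hAs hAT (min_le_right (c - 1) (δ / 2))
        (formOp_pos_of_bounded_below hS0 hc ((min_le_left _ _).trans_lt (sub_one_lt c))) hWp' hW'
    -- Here positivity holds for large `l`, so the path is traversed backwards through `l ↦ -l`.
    · obtain ⟨ev, h⟩ := exists_kernels_of_path (A := fun l => A (-l)) (hAc.comp continuous_neg)
        (fun l => hAs (-l)) (fun l => hAT (-l))
        (a := -(max (M - c + 1) (δ / 2))) (b := -(δ / 2)) (neg_le_neg (le_max_right _ _))
        (by
          rw [neg_neg]
          exact formOp_pos_of_neg_bounded_below hM hSlow hc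
            ((lt_add_one _).trans_le (le_max_left _ _)))
        hWp' (by rwa [neg_neg])
      exact ⟨fun i => -ev i, fun i => by simpa only [neg_inj] using h i⟩
  obtain ⟨ev, hev⟩ := hev
  have hmult : ∀ i, (Finset.univ.filter fun j => ev j = ev i).card ≤ multiplicity P Ω V (ev i) :=
    fun i => (hev i).trans_eq (multiplicity_eq_finrank_ker hVi hVC hVpos (ev i)).symm
  refine ⟨ev, fun i => ?_, hmult⟩
  -- Each value occurs at least once, so its `finrank` is positive; this rules out the default 0 for
  -- infinite dimension and supplies a nonzero kernel element.
  have hpos : 0 < Module.finrank ℂ (kerT P Ω V (ev i : ℂ)) :=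
    (Finset.card_pos.2 ⟨i, by simp⟩).trans_le (hmult i)
  have := Module.nontrivial_of_finrank_pos hpos
  obtain ⟨u, hu⟩ := exists_ne (0 : kerT P Ω V (ev i : ℂ))
  exact isTransmissionEigenvalue_of_mem_kerT hΩb (by omega) hVi hVC hVM u.2
    fun h => hu (Subtype.ext h)
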